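/- For $n\ge 1$ let $\mathrm{Br}_n$ be the braid group on $n$ strands with Artin generators $\sigma_1,\dots,\sigma_{n-1}$ and relations $\sigma_i\sigma_{i+1}\sigma_i=\sigma_{i+1}\sigma_i\sigma_{i+1}$ for $1\le i\le n-2$ and $\sigma_i\sigma_j=\sigma_j\sigma_i$ for $|i-j|\ge 2$. A (positive) half twist is an element of $\mathrm{Br}_n$ that is conjugate in $\mathrm{Br}_n$ to a generator $\sigma_i$ (geometrically: the half twist about an embedded arc joining two of the $n$ punctures of the disc). For $1\le i<j\le n$ put $m_{ij}=1$ if $i\equiv j \pmod 2$ and $m_{ij}=3$ otherwise, let $$e_{ij}=\sigma_{j-1}\cdots\sigma_{i+1}\,\sigma_i^{m_{ij}}\,\sigma_{i+1}^{-1}\cdots\sigma_{j-1}^{-1},$$ and let $E_n\subseteq\mathrm{Br}_n$ be the subgroup generated by all $e_{ij}$, $1\le i<j\le n$. In particular $e_{13}=\sigma_2\sigma_1\sigma_2^{-1}$. Let $3\le n\le 6$. Then the set of half twists of $\mathrm{Br}_n$ that lie in $E_n$ is exactly the conjugacy class of $e_{13}$ in $E_n$: $$\{\beta\in\mathrm{Br}_n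 : \beta \text{ is a half twist}\}\cap E_n=\{g^{-1}e_{13}\,g : g\in E_n\}.$$ -/

import Mathlib

namespace ArtinBraid

/-- Index set `1, …, n - 1` of the Artin generators of the braid group on `n` strands. -/
abbrev Gen (n : ℕ) : Type := {i : ℕ // 1 ≤ i ∧ i < n}

/-- The Artin relators: `σ_i σ_{i+1} σ_i = σ_{i+1} σ_i σ_{i+1}`, and `σ_i σ_j = σ_j σ_i`
for `i + 1 < j`. -/
def rels (n : ℕ) : Set (FreeGroup (Gen n)) :=
  {r | (∃ i j : Gen n, i.1 + 1 = j.1 ∧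
        r = (FreeGroup.of i * FreeGroup.of j * FreeGroup.of i) *
          (FreeGroup.of j * FreeGroup.of i * FreeGroup.of j)⁻¹) ∨
      (∃ i j : Gen n, i.1 + 1 < j.1 ∧
        r = (FreeGroup.of i * FreeGroup.of j) * (FreeGroup.of j * FreeGroup.of i)⁻¹)}

/-- The braid group `Br_n` on `n` strands, in Artin's presentation. -/
abbrev Br (n : ℕ) : Type := PresentedGroup (rels n)

/-- The Artin generator `σ_i` of `Br_n`, `1 ≤ i < n` (with value `1` for other `i`). -/
def sigma (n i : ℕ) : Br n :=
  if h : 1 ≤ i ∧ i < n then PresentedGroup.of ⟨i, h⟩ else 1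

/-- A (positive) half twist in `Br_n`. The `σ_i` are the half twists about the segments joining
neighbouring punctures; every arc joining two punctures is the image of such a segment under some
braid, and the half twist about the image is the corresponding conjugate of `σ_i`. -/
def IsHalfTwist {n : ℕ} (β : Br n) : Prop :=
  ∃ i : ℕ, 1 ≤ i ∧ i < n ∧ ∃ g : Br n, β = g⁻¹ * sigma n i * g

/-- The entry `m_{ij}` of the matrix `M_n`: `1` if `i ≡ j` modulo `2`, and `3` otherwise. -/
def m (i j : ℕ) : ℕ := if i % 2 = j % 2 then 1 else 3

/-- The product `σ_{j-1} σ_{j-2} ⋯ σ_{i+1}` (empty if `j = i + 1`). -/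
def descProd (n i j : ℕ) : Br n :=
  ((List.range' (i + 1) (j - (i + 1))).reverse.map (sigma n)).prod

/-- The element `e_{ij} = σ_{j-1} ⋯ σ_{i+1} σ_i ^ m_{ij} σ_{i+1}⁻¹ ⋯ σ_{j-1}⁻¹`, `i < j`. -/
def e (n i j : ℕ) : Br n :=
  descProd n i j * sigma n i ^ m i j * (descProd n i j)⁻¹

/-- The subgroup `E_n` of `Br_n` generated by all `e_{ij}`, `1 ≤ i < j ≤ n`. -/
def E (n : ℕ) : Subgroup (Br n) :=
  Subgroup.closure {β | ∃ i j : ℕ, 1 ≤ i ∧ i < j ∧ j ≤ n ∧ β = e n i j}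

end ArtinBraid

/-! Let `Br n` act on colourings of the positions by elements of F_7, through the Burau
representation at the primitive sixth root of unity 3. A twist fixes every colouring whose two
entries at its position agree, and its cube is trivial. Hence every e_{ij} fixes the alternating
colouring (`burau_e`), and so does all of `E n`. If g⁻¹ σ_1 g lies in `E n`, then g carries the
alternating colouring to one with equal entries at positions 1 and 2 (`burau_of_conj_mem_E`).

All σ_i are conjugate, so every half twist is some g⁻¹ σ_1 g. Whether it lies in `E n`, and its
class under `E n`, depend only on the double coset Z(σ_1) g E_n. As e_{13} = σ_2 σ_1 σ_2⁻¹, the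
claim is that only the double coset of σ_2⁻¹ contributes. It does no harm to enlarge `E n` by a
subgroup C that centralises e_{13} and normalises `E n`. There are then finitely many cosets of E_n
C to inspect: each one is excluded by its colouring, or is joined to the coset of σ_2⁻¹ by an
explicit word centralising σ_1 (`halfTwist_inter_E`).

C is trivial for n = 3, 4 and is generated by the central element δ^5 for n = 5. For n = 6 it is
generated by a loop `push` of the last strand and its conjugate by δ; that these normalise `E 6` is
again proved by coset enumeration.

Each enumeration is a Todd–Coxeter table stored as a certificate, every edge carrying the loop that
forces it (`sound_of_check`). Only the listed edges and closure under the generators matter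
(`exists_node`): distinctness of the nodes is never needed. -/

/-! ## Verified coset scanning

Letters are coded by natural numbers: `2 * i` stands for the generator `gen i` and `2 * i + 1` for
its inverse. Nodes are points `wordVal gen w • x₀` of a `G`-set, and an edge `(c, i, j)` records that
the letter `c` maps node `i` to node `j`. -/

namespace CosetScan

variable {G S : Type*} [Group G] [MulAction G S]

/-- The group element coded by a letter. -/
def letterVal (gen : ℕ → G) (c : ℕ) : G :=
  if c % 2 = 0 then gen (c / 2) else (gen (c / 2))⁻¹

/-- The group element coded by a word. -/
def wordVal (gen : ℕ → G) (w : List ℕ) : G := (w.map (letterVal gen)).prod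

/-- The code of the inverse letter. -/
def invLetter (c : ℕ) : ℕ := if c % 2 = 0 then c + 1 else c - 1

/-- The formal inverse of a word. -/
def invWord (w : List ℕ) : List ℕ := w.reverse.map invLetter

variable (gen : ℕ → G)

@[simp] theorem letterVal_invLetter (c : ℕ) :
    letterVal gen (invLetter c) = (letterVal gen c)⁻¹ := by
  unfold letterVal invLetter
  rcases Nat.mod_two_eq_zero_or_one c with h | h
  · have h1 : (c + 1) % 2 = 1 := by omega
    have h2 : (c + 1) / 2 = c / 2 := by omega
    simp [h, h1, h2]
  · have h1 : (c - 1) % 2 = 0 := by omega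
    have h2 : (c - 1) / 2 = c / 2 := by omega
    simp [h, h1, h2]

@[simp] theorem wordVal_nil : wordVal gen [] = 1 := rfl

@[simp] theorem wordVal_cons (c : ℕ) (w : List ℕ) :
    wordVal gen (c :: w) = letterVal gen c * wordVal gen w := by
  simp [wordVal]

@[simp] theorem wordVal_append (u w : List ℕ) :
    wordVal gen (u ++ w) = wordVal gen u * wordVal gen w := by
  simp [wordVal]

@[simp] theorem wordVal_invWord (w : List ℕ) : wordVal gen (invWord w) = (wordVal gen w)⁻¹ := by
  induction w with
  | nil => simp [invWord]
  | cons c w ih =>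
    have : invWord (c :: w) = invWord w ++ [invLetter c] := by simp [invWord]
    simp [this, ih]

/-- An edge `(c, i, j)` together with its justification `(t, k)`: see `CosetScan.valid`. -/
abbrev Edge : Type := ℕ × ℕ × ℕ × ℕ × ℕ

/-- The target of the letter `c` at node `k`, according to a list of edges with even letters. It is
written with recursors, which the kernel evaluates fast. -/
noncomputable def next (F : List Edge) (c k : ℕ) : Option ℕ :=
  List.rec none (fun f _ ih =>
    Bool.rec
      (Bool.rec ih (Bool.rec ih (some f.2.1) (Nat.beq f.2.2.1 k)) (Nat.beq (Nat.succ f.1) c))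
      (Bool.rec ih (some f.2.2.1) (Nat.beq f.2.1 k)) (Nat.beq f.1 c)) F

/-- The recursors in `next` serve kernel evaluation; all reasoning goes through this form. An edge
with even letter c also answers queries for c + 1, read backwards. -/
theorem next_cons (f : Edge) (F : List Edge) (c k : ℕ) :
    next (f :: F) c k =
      if f.1 = c then (if f.2.1 = k then some f.2.2.1 else next F c k)
      else if f.1 + 1 = c then (if f.2.2.1 = k then some f.2.1 else next F c k)
      else next F c k := by
  have key : ∀ (a b : ℕ) (x y : Option ℕ),
      (Bool.rec x y (Nat.beq a b) : Option ℕ) = if a = b then y else x := by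
    intro a b x y
    split_ifs with h
    · subst h
      have : Nat.beq a a = true := Nat.beq_refl a
      rw [this]
    · have : Nat.beq a b = false := by
        rw [← Bool.not_eq_true]
        exact fun hb => h (Nat.eq_of_beq_eq_true hb)
      rw [this]
  rw [← key f.1, ← key f.2.1, ← key (f.1 + 1), ← key f.2.2.1]
  rfl

/-- Follow a word, its first letter being applied first, as long as edges are known. Returns the
last node and the unread rest of the word. -/
noncomputable def walk (F : List Edge) : List ℕ → ℕ → ℕ × List ℕ
  | [], k => (k, [])
  | c :: w, k =>
    match next F c k with
    | none => (k, c :: w)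
    | some j => walk F w j

/-- The loop with index `t` at node `k`: a word in `R` at any node, or a word in `H` at node `0`. -/
def loopWord (R H : List (List ℕ)) (t k : ℕ) : List ℕ :=
  bif Nat.blt t R.length then R.getD t [] else bif Nat.beq k 0 then H.getD (t - R.length) [] else []

/-- An edge is valid over known edges `F` if it holds by the definition of the nodes (`t = 0`), or if
it closes the only gap in the loop with index `t - 1` at node `k`. -/
noncomputable def valid (W R H : List (List ℕ)) (F : List Edge) : Edge → Bool
  | (c, i, j, 0, _) =>
    (c % 2 == 0) && (W.getD j [] == c :: W.getD i [] || W.getD i [] == (c + 1) :: W.getD j [])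
  | (c, i, j, t + 1, k) =>
    (c % 2 == 0) &&
    match walk F (loopWord R H t k).reverse k with
    | (_, []) => false
    | (i', c' :: r) =>
      match walk F (invWord r) k with
      | (j', []) => (c' == c && i' == i && j' == j) || (c' == c + 1 && i' == j && j' == i)
      | (_, _ :: _) => false

/-- Every edge of the list is valid over the edges after it. -/
noncomputable def check (W R H : List (List ℕ)) : List Edge → Bool
  | [] => true
  | f :: F => valid W R H F f && check W R H F

/-- The nodes. -/
def node (W : List (List ℕ)) (x₀ : S) (k : ℕ) : S := wordVal gen (W.getD k []) • x₀

/-- All edges hold. -/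
def Sound (p : ℕ → S) (F : List Edge) : Prop :=
  ∀ f ∈ F, f.1 % 2 = 0 ∧ letterVal gen f.1 • p f.2.1 = p f.2.2.1

variable {gen}

theorem letterVal_succ {c : ℕ} (h : c % 2 = 0) :
    letterVal gen (c + 1) = (letterVal gen c)⁻¹ := by
  rw [← letterVal_invLetter]
  simp [invLetter, h]

theorem Sound.next {p : ℕ → S} {F : List Edge} (hF : Sound gen p F) {c k j : ℕ}
    (h : next F c k = some j) : letterVal gen c • p k = p j := by
  induction F with
  | nil => simp [CosetScan.next] at h
  | cons f F ih =>
    obtain ⟨h0, h1⟩ := hF _ (List.mem_cons_self)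
    have ih' := ih (fun f hf => hF f (List.mem_cons_of_mem _ hf))
    rw [next_cons] at h
    split_ifs at h with ha hb hb hc
    · rw [← ha, ← hb, h1, Option.some.inj h]
    · exact ih' h
    · rw [← hb, ← hc, letterVal_succ h0, ← h1, inv_smul_smul, Option.some.inj h]
    · exact ih' h
    · exact ih' h

/-- In a left action the last letter of a word acts first, whereas a walk applies its first letter
first; hence the reversal of the prefix that was read. -/
theorem Sound.walk {p : ℕ → S} {F : List Edge} (hF : Sound gen p F) (w : List ℕ) :
    ∀ {k k' : ℕ} {r : List ℕ}, walk F w k = (k', r) →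
      ∃ u, w = u ++ r ∧ wordVal gen u.reverse • p k = p k' := by
  induction w with
  | nil =>
    intro k k' r h
    simp only [CosetScan.walk, Prod.mk.injEq] at h
    exact ⟨[], by simp [← h.2], by simp [h.1]⟩
  | cons c w ih =>
    intro k k' r h
    simp only [CosetScan.walk] at h
    split at h
    · simp only [Prod.mk.injEq] at h
      exact ⟨[], by simp [← h.2], by simp [h.1]⟩
    · rename_i j hj
      obtain ⟨u, rfl, hu⟩ := ih h
      refine ⟨c :: u, rfl, ?_⟩
      rw [List.reverse_cons, wordVal_append, mul_smul, wordVal_cons, wordVal_nil, mul_one,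
        hF.next hj, hu]

theorem Sound.walk_all {p : ℕ → S} {F : List Edge} (hF : Sound gen p F) {w : List ℕ} {k k' : ℕ}
    (h : CosetScan.walk F w.reverse k = (k', [])) : wordVal gen w • p k = p k' := by
  obtain ⟨u, hu, hp⟩ := hF.walk _ h
  rw [List.append_nil] at hu
  rwa [← hu, List.reverse_reverse] at hp

/-- Relators fix every node, words of the subgroup only the base node. Every other index, in
particular one out of range, falls back to the empty word, so a faulty certificate cannot yield a
false loop. -/
theorem loopWord_smul {W R H : List (List ℕ)} {x₀ : S}
    (hR : ∀ w ∈ R, ∀ x : S, wordVal gen w • x = x)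
    (hH : ∀ w ∈ H, wordVal gen w • node gen W x₀ 0 = node gen W x₀ 0) (t k : ℕ) :
    wordVal gen (loopWord R H t k) • node gen W x₀ k = node gen W x₀ k := by
  have key : ∀ (L : List (List ℕ)) (s : ℕ), L.getD s [] ∈ L ∨ L.getD s [] = [] := by
    intro L s
    by_cases hs : s < L.length
    · left
      rw [List.getD_eq_getElem _ _ hs]
      exact List.getElem_mem hs
    · right
      exact List.getD_eq_default _ _ (not_lt.1 hs)
  unfold loopWord
  simp only [cond_eq_ite]
  split_ifs with h1 h2
  · rcases key R t with h | h
    · exact hR _ h _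
    · rw [h, wordVal_nil, one_smul]
  · obtain rfl := Nat.eq_of_beq_eq_true h2
    rcases key H (t - R.length) with h | h
    · exact hH _ h
    · rw [h, wordVal_nil, one_smul]
  · rw [wordVal_nil, one_smul]

/-- Edges are stored newest first, so the tail of the list is sound by induction when the head is
examined. -/
theorem sound_of_check {W R H : List (List ℕ)} {x₀ : S}
    (hR : ∀ w ∈ R, ∀ x : S, wordVal gen w • x = x)
    (hH : ∀ w ∈ H, wordVal gen w • node gen W x₀ 0 = node gen W x₀ 0) :
    ∀ {F : List Edge}, check W R H F = true → Sound gen (node gen W x₀) F := by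
  intro F
  induction F with
  | nil => intro _ f hf; simp at hf
  | cons f F ih =>
    intro h
    simp only [check, Bool.and_eq_true] at h
    obtain ⟨hv, hc⟩ := h
    have hF := ih hc
    intro g hg
    rcases List.mem_cons.1 hg with rfl | hg
    swap
    · exact hF g hg
    obtain ⟨c, i, j, t, k⟩ := g
    simp only
    cases t with
    | zero =>
      simp only [valid, Bool.and_eq_true, Bool.or_eq_true, beq_iff_eq] at hv
      refine ⟨hv.1, ?_⟩
      rcases hv.2 with h | h
      · rw [node, node, h, wordVal_cons, mul_smul]
      · rw [node, node, h, wordVal_cons, mul_smul, letterVal_succ hv.1, smul_inv_smul]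
    | succ t =>
      simp only [valid, Bool.and_eq_true, beq_iff_eq] at hv
      obtain ⟨h0, hv⟩ := hv
      refine ⟨h0, ?_⟩
      split at hv
      · simp at hv
      rename_i i' c' r hw
      split at hv
      swap
      · simp at hv
      rename_i j' hw'
      obtain ⟨u, hu, hpu⟩ := hF.walk _ hw
      obtain ⟨u', hu', hpu'⟩ := hF.walk _ hw'
      rw [List.append_nil] at hu'
      have hl := loopWord_smul hR hH t k
      -- In walking order the loop reads `u`, the unknown letter `c'`, then `r`. The stretch `r` was
      -- followed backwards from the end of the loop, so cancelling both known stretches leaves the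
      -- edge for `c'`.
      have e1 : loopWord R H t k = r.reverse ++ [c'] ++ u.reverse := by
        rw [← List.reverse_reverse (loopWord R H t k), hu]
        simp
      have e2 : u'.reverse = (r.map invLetter) := by
        rw [← hu', invWord, ← List.map_reverse, List.reverse_reverse]
      have e3 : r.map invLetter = invWord r.reverse := by
        simp [invWord]
      rw [e2, e3, wordVal_invWord, inv_smul_eq_iff] at hpu'
      rw [e1, wordVal_append, wordVal_append, mul_smul, mul_smul, hpu] at hl
      rw [hpu'] at hl
      have hc' : letterVal gen c' • node gen W x₀ i' = node gen W x₀ j' := by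
        have := MulAction.injective (wordVal gen r.reverse) hl
        simpa using this
      simp only [Bool.or_eq_true, Bool.and_eq_true, beq_iff_eq] at hv
      rcases hv with ⟨⟨rfl, rfl⟩, rfl⟩ | ⟨⟨rfl, rfl⟩, rfl⟩
      · exact hc'
      · rw [letterVal_succ h0, inv_smul_eq_iff] at hc'
        exact hc'.symm

end CosetScan

open CosetScan

namespace ArtinBraid

/-! ### Artin relations and products of consecutive generators. -/

theorem sigma_of_not {n i : ℕ} (h : ¬(1 ≤ i ∧ i < n)) : sigma n i = 1 := by
  simp [sigma, h]

theorem sigma_braid {n i : ℕ} (hi : 1 ≤ i) (h : i + 1 < n) :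
    sigma n i * sigma n (i + 1) * sigma n i = sigma n (i + 1) * sigma n i * sigma n (i + 1) := by
  have h1 : 1 ≤ i ∧ i < n := by omega
  have h2 : 1 ≤ i + 1 ∧ i + 1 < n := by omega
  have : PresentedGroup.mk (rels n)
      ((FreeGroup.of ⟨i, h1⟩ * FreeGroup.of ⟨i + 1, h2⟩ * FreeGroup.of ⟨i, h1⟩) *
        (FreeGroup.of ⟨i + 1, h2⟩ * FreeGroup.of ⟨i, h1⟩ * FreeGroup.of ⟨i + 1, h2⟩)⁻¹) = 1 :=
    PresentedGroup.one_of_mem (Or.inl ⟨_, _, rfl, rfl⟩)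
  rw [map_mul, map_inv, mul_inv_eq_one] at this
  simpa [sigma, h1, h2, PresentedGroup.of] using this

theorem sigma_comm {n i j : ℕ} (h : i + 1 < j) : Commute (sigma n i) (sigma n j) := by
  by_cases hi : 1 ≤ i ∧ i < n
  swap
  · rw [sigma_of_not hi]; exact Commute.one_left _
  by_cases hj : 1 ≤ j ∧ j < n
  swap
  · rw [sigma_of_not hj]; exact Commute.one_right _
  have : PresentedGroup.mk (rels n)
      ((FreeGroup.of ⟨i, hi⟩ * FreeGroup.of ⟨j, hj⟩) *
        (FreeGroup.of ⟨j, hj⟩ * FreeGroup.of ⟨i, hi⟩)⁻¹) = 1 :=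
    PresentedGroup.one_of_mem (Or.inr ⟨_, _, h, rfl⟩)
  rw [map_mul, map_inv, mul_inv_eq_one] at this
  simpa [sigma, hi, hj, PresentedGroup.of, Commute, SemiconjBy] using this

theorem descProd_self (n i j : ℕ) (h : j ≤ i + 1) : descProd n i j = 1 := by
  have : j - (i + 1) = 0 := by omega
  simp [descProd, this]

theorem descProd_succ (n : ℕ) {i j : ℕ} (h : i + 1 ≤ j) :
    descProd n i (j + 1) = sigma n j * descProd n i j := by
  have h1 : j + 1 - (i + 1) = (j - (i + 1)) + 1 := by omega
  have h2 : i + 1 + (j - (i + 1)) = j := by omega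
  simp [descProd, h1, List.range'_concat, h2]

/-- A product of consecutive generators splits. -/
theorem descProd_mul (n : ℕ) {i k j : ℕ} (hik : i ≤ k) (hkj : k + 1 ≤ j) :
    descProd n k j * descProd n i (k + 1) = descProd n i j := by
  induction j, hkj using Nat.le_induction with
  | base => rw [descProd_self n k (k + 1) le_rfl, one_mul]
  | succ j hj ih => rw [descProd_succ n hj, descProd_succ n (show i + 1 ≤ j by omega), mul_assoc, ih]

theorem commute_sigma_descProd_of_lt {n a i j : ℕ} (h : a < i) :
    Commute (sigma n a) (descProd n i j) := by
  unfold descProd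
  refine Commute.list_prod_right _ _ fun x hx => ?_
  simp only [List.mem_map, List.mem_reverse, List.mem_range'_1] at hx
  obtain ⟨b, hb, rfl⟩ := hx
  exact sigma_comm (by omega)

theorem commute_sigma_descProd_of_gt {n a i j : ℕ} (h : j < a + 1) :
    Commute (sigma n (a + 1)) (descProd n i j) := by
  unfold descProd
  refine Commute.list_prod_right _ _ fun x hx => ?_
  simp only [List.mem_map, List.mem_reverse, List.mem_range'_1] at hx
  obtain ⟨b, hb, rfl⟩ := hx
  exact (sigma_comm (by omega)).symm

/-! ### The rotation δ and the central full twist. -/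

/-- The rotation `δ = σ_{n-1} ⋯ σ_1`. -/
def delta (n : ℕ) : Br n := descProd n 0 n

/-- Only the adjacent factors σ_{i+1} σ_i of δ interact with the moving generator: σ_i passes the
factors to their left, and after one braid relation σ_{i+1} passes those to their right. -/
theorem sigma_mul_delta {n i : ℕ} (hi : 1 ≤ i) (h : i + 1 < n) :
    sigma n i * delta n = delta n * sigma n (i + 1) := by
  obtain ⟨k, rfl⟩ : ∃ k, i = k + 1 := ⟨i - 1, by omega⟩
  have hd : delta n = descProd n (k + 2) n * (sigma n (k + 1 + 1) * sigma n (k + 1)) *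
      descProd n 0 (k + 1) := by
    rw [delta, ← descProd_mul n (Nat.zero_le (k + 2)) (by omega), descProd_succ n (by omega),
      descProd_succ n (by omega)]
    simp only [mul_assoc]
  have c1 : sigma n (k + 1) * descProd n (k + 2) n = descProd n (k + 2) n * sigma n (k + 1) :=
    commute_sigma_descProd_of_lt (by omega)
  have c2 : sigma n (k + 1 + 1) * descProd n 0 (k + 1) =
      descProd n 0 (k + 1) * sigma n (k + 1 + 1) :=
    commute_sigma_descProd_of_gt (by omega)
  have hb := sigma_braid (n := n) (i := k + 1) (by omega) h
  generalize descProd n (k + 2) n = X at *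
  generalize descProd n 0 (k + 1) = Y at *
  generalize sigma n (k + 1) = s at *
  generalize sigma n (k + 1 + 1) = t at *
  calc s * delta n = s * X * t * s * Y := by rw [hd]; simp only [mul_assoc]
    _ = X * (s * t * s) * Y := by rw [c1]; simp only [mul_assoc]
    _ = X * t * s * (t * Y) := by rw [hb]; simp only [mul_assoc]
    _ = delta n * t := by rw [c2, hd]; simp only [mul_assoc]

/-- The product `σ_1 ⋯ σ_k`. -/
def ascProd (n k : ℕ) : Br n := ((List.range' 1 k).map (sigma n)).prod

theorem ascProd_succ (n k : ℕ) : ascProd n (k + 1) = ascProd n k * sigma n (k + 1) := by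
  simp [ascProd, List.range'_concat, Nat.add_comm]

theorem commute_sigma_ascProd {n a k : ℕ} (h : k < a) :
    Commute (sigma n (a + 1)) (ascProd n k) := by
  unfold ascProd
  refine Commute.list_prod_right _ _ fun x hx => ?_
  simp only [List.mem_map, List.mem_range'_1] at hx
  obtain ⟨b, hb, rfl⟩ := hx
  exact (sigma_comm (by omega)).symm

/-- The ascending product shifts indices in the direction opposite to δ; the two shifts cancel in
`commute_push_sigma`. -/
theorem sigma_mul_ascProd {n i k : ℕ} (hi : 1 ≤ i) (h : i + 1 ≤ k) (hk : k < n) :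
    sigma n (i + 1) * ascProd n k = ascProd n k * sigma n i := by
  induction k, h using Nat.le_induction with
  | base =>
    obtain ⟨j, rfl⟩ : ∃ j, i = j + 1 := ⟨i - 1, by omega⟩
    have hb := sigma_braid (n := n) (i := j + 1) hi hk
    have hc : sigma n (j + 1 + 1) * ascProd n j = ascProd n j * sigma n (j + 1 + 1) :=
      commute_sigma_ascProd (by omega)
    rw [ascProd_succ, ascProd_succ, ← mul_assoc, ← mul_assoc, hc]
    simp only [mul_assoc] at hb ⊢
    rw [← hb]
  | succ k hk' ih =>
    have hc : sigma n i * sigma n (k + 1) = sigma n (k + 1) * sigma n i := sigma_comm (by omega)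
    rw [ascProd_succ, ← mul_assoc, ih (by omega), mul_assoc, hc, mul_assoc]

/-- `δ² σ_1 = σ_{n-1} δ²`. -/
theorem sigma_mul_delta_sq {n : ℕ} (hn : 2 ≤ n) :
    sigma n (n - 1) * (delta n * delta n) = delta n * delta n * sigma n 1 := by
  -- Passing δ turns σ_k ⋯ σ_1 into σ_{k+1} ⋯ σ_2. For k = n - 2 the latter is δ without its last
  -- factor σ_1.
  have key : ∀ k, k + 1 < n → descProd n 0 (k + 1) * delta n = delta n * descProd n 1 (k + 2) := by
    intro k hk
    induction k with
    | zero => rw [descProd_self n 0 1 le_rfl, descProd_self n 1 2 le_rfl, one_mul, mul_one]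
    | succ k ih =>
      rw [descProd_succ n (by omega), mul_assoc, ih (by omega), ← mul_assoc,
        sigma_mul_delta (by omega) hk, descProd_succ n (show 1 + 1 ≤ k + 2 by omega), mul_assoc]
  obtain ⟨k, rfl⟩ : ∃ k, n = k + 2 := ⟨n - 2, by omega⟩
  have h1 : delta (k + 2) = descProd (k + 2) 1 (k + 2) * sigma (k + 2) 1 := by
    rw [delta, ← descProd_mul _ (Nat.zero_le 1) (by omega : 1 + 1 ≤ k + 2),
      descProd_succ _ (show 0 + 1 ≤ 1 by omega), descProd_self _ 0 1 le_rfl, mul_one]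
  have h2 : delta (k + 2) = sigma (k + 2) (k + 1) * descProd (k + 2) 0 (k + 1) := by
    rw [delta, descProd_succ _ (by omega)]
  have h3 : delta (k + 2) * delta (k + 2) =
      descProd (k + 2) 0 (k + 1) * delta (k + 2) * sigma (k + 2) 1 := by
    rw [key k (by omega), mul_assoc, ← h1]
  calc sigma (k + 2) (k + 1) * (delta (k + 2) * delta (k + 2))
      = sigma (k + 2) (k + 1) * descProd (k + 2) 0 (k + 1) * delta (k + 2) * sigma (k + 2) 1 := by
        rw [h3]; simp only [mul_assoc]
    _ = delta (k + 2) * delta (k + 2) * sigma (k + 2) 1 := by rw [← h2]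

theorem sigma_mul_delta_pow {n i k : ℕ} (hi : 1 ≤ i) (h : i + k < n) :
    sigma n i * delta n ^ k = delta n ^ k * sigma n (i + k) := by
  induction k with
  | zero => simp
  | succ k ih =>
    rw [pow_succ, ← mul_assoc, ih (by omega), mul_assoc, sigma_mul_delta (by omega) (by omega),
      mul_assoc, add_assoc]

/-- The full twist `δ ^ n` is central. -/
theorem commute_sigma_delta_pow (n i : ℕ) : Commute (sigma n i) (delta n ^ n) := by
  by_cases h : 1 ≤ i ∧ i < n
  swap
  · rw [sigma_of_not h]; exact Commute.one_left _
  have h1 := sigma_mul_delta_pow (n := n) (i := i) (k := n - 1 - i) h.1 (by omega)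
  have h2 := sigma_mul_delta_sq (n := n) (by omega)
  have h3 := sigma_mul_delta_pow (n := n) (i := 1) (k := i - 1) le_rfl (by omega)
  rw [show i + (n - 1 - i) = n - 1 by omega] at h1
  rw [show 1 + (i - 1) = i by omega] at h3
  -- Moving through δ^n from the left, σ_i climbs to σ_{n-1}, becomes σ_1 across δ², and climbs back
  -- to σ_i.
  have hp : delta n ^ n = delta n ^ (n - 1 - i) * (delta n * delta n) * delta n ^ (i - 1) := by
    rw [← pow_two, ← pow_add, ← pow_add]
    congr 1
    omega
  rw [Commute, SemiconjBy, hp]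
  calc sigma n i * (delta n ^ (n - 1 - i) * (delta n * delta n) * delta n ^ (i - 1))
      = sigma n i * delta n ^ (n - 1 - i) * (delta n * delta n) * delta n ^ (i - 1) := by
        simp only [mul_assoc]
    _ = delta n ^ (n - 1 - i) * (sigma n (n - 1) * (delta n * delta n)) * delta n ^ (i - 1) := by
        rw [h1]; simp only [mul_assoc]
    _ = delta n ^ (n - 1 - i) * (delta n * delta n) * (sigma n 1 * delta n ^ (i - 1)) := by
        rw [h2]; simp only [mul_assoc]
    _ = _ := by rw [h3]; simp only [mul_assoc]

theorem closure_sigma (n : ℕ) :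
    Subgroup.closure {x : Br n | ∃ i, 1 ≤ i ∧ i < n ∧ x = sigma n i} = ⊤ := by
  rw [eq_top_iff, ← PresentedGroup.closure_range_of (rels n)]
  refine Subgroup.closure_mono ?_
  rintro _ ⟨⟨i, hi⟩, rfl⟩
  exact ⟨i, hi.1, hi.2, by simp [sigma, hi]⟩

theorem sigma_isConj_one {n i : ℕ} (hi : 1 ≤ i) (h : i < n) :
    ∃ g : Br n, sigma n i = g⁻¹ * sigma n 1 * g := by
  have := sigma_mul_delta_pow (n := n) (i := 1) (k := i - 1) le_rfl (by omega)
  rw [show 1 + (i - 1) = i by omega] at this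
  exact ⟨delta n ^ (i - 1), by rw [mul_assoc, this, inv_mul_cancel_left]⟩

theorem e_mem_E {n i j : ℕ} (hi : 1 ≤ i) (hij : i < j) (hj : j ≤ n) : e n i j ∈ E n :=
  Subgroup.subset_closure ⟨i, j, hi, hij, hj, rfl⟩

theorem e_one_three (n : ℕ) : e n 1 3 = sigma n 2 * sigma n 1 * (sigma n 2)⁻¹ := by
  simp [e, m, descProd]

/-! ### A small generating set of `E n`. -/

/-- `E_n` is generated by `σ_1 ^ 3` and the `e_{i,i+2}`. -/
theorem E_le {n : ℕ} {K : Subgroup (Br n)} (h1 : sigma n 1 ^ 3 ∈ K)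
    (h2 : ∀ i, 1 ≤ i → i + 2 ≤ n → e n i (i + 2) ∈ K) : E n ≤ K := by
  have e2 : ∀ i, e n i (i + 2) = sigma n (i + 1) * sigma n i * (sigma n (i + 1))⁻¹ := by
    intro i
    simp [e, m, descProd]
  have e1 : ∀ i, e n i (i + 1) = sigma n i ^ 3 := by
    intro i
    have : i % 2 ≠ (i + 1) % 2 := by omega
    simp [e, m, descProd, this]
  -- By the braid relation e_{i,i+2} conjugates σ_i to σ_{i+1}, so the cubes propagate from σ_1^3.
  have s3 : ∀ i, 1 ≤ i → i + 1 ≤ n → sigma n i ^ 3 ∈ K := by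
    intro i hi
    induction i, hi using Nat.le_induction with
    | base => exact fun _ => h1
    | succ i hi ih =>
      intro hn
      have ha := h2 i hi (by omega)
      have hb := sigma_braid (n := n) hi (by omega)
      have hs : sigma n (i + 1) = (e n i (i + 2))⁻¹ * sigma n i * e n i (i + 2) := by
        rw [mul_assoc, eq_inv_mul_iff_mul_eq, e2, inv_mul_cancel_right, ← mul_assoc, ← mul_assoc,
          eq_mul_inv_iff_mul_eq, hb]
      rw [hs]
      have : ((e n i (i + 2))⁻¹ * sigma n i * e n i (i + 2)) ^ 3 =
          (e n i (i + 2))⁻¹ * sigma n i ^ 3 * e n i (i + 2) := by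
        simp [pow_succ, mul_assoc]
      rw [this]
      exact K.mul_mem (K.mul_mem (K.inv_mem ha) (ih (by omega))) ha
  -- Lengthening the arc by two conjugates by σ_{j+1} σ_j and keeps the exponent. Since σ_{j+1}
  -- commutes with e_{ij}, this is conjugation by e_{j,j+2}.
  have step : ∀ i j, 1 ≤ i → i + 1 ≤ j → j + 2 ≤ n →
      e n i (j + 2) = e n j (j + 2) * e n i j * (e n j (j + 2))⁻¹ := by
    intro i j hi hij hj
    have hm : m i (j + 2) = m i j := by simp [m]
    have hc1 : Commute (sigma n (j + 1)) (descProd n i j) :=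
      commute_sigma_descProd_of_gt (by omega)
    have hc2 : Commute (sigma n (j + 1)) (sigma n i) := (sigma_comm (by omega)).symm
    have hc : Commute (sigma n (j + 1)) (e n i j) :=
      (hc1.mul_right (hc2.pow_right _)).mul_right hc1.inv_right
    have hc' : (sigma n (j + 1))⁻¹ * e n i j * sigma n (j + 1) = e n i j := by
      rw [mul_assoc, ← hc.eq, inv_mul_cancel_left]
    have : e n i (j + 2) = sigma n (j + 1) * sigma n j * e n i j *
        ((sigma n j)⁻¹ * (sigma n (j + 1))⁻¹) := by
      simp only [e, hm, descProd_succ n (by omega : i + 1 ≤ j + 1), descProd_succ n hij,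
        mul_inv_rev, mul_assoc]
    rw [this, e2]
    conv_lhs => rw [← hc']
    simp only [mul_inv_rev, inv_inv, mul_assoc]
  have all : ∀ j i, 1 ≤ i → i < j → j ≤ n → e n i j ∈ K := by
    intro j
    induction j using Nat.strong_induction_on with
    | _ j ih =>
      intro i hi hij hj
      obtain rfl | rfl | ⟨k, rfl, hk⟩ : j = i + 1 ∨ j = i + 2 ∨ ∃ k, j = k + 2 ∧ i + 1 ≤ k := by
        rcases Nat.lt_or_ge j (i + 3) with h | h
        · omega
        · exact Or.inr (Or.inr ⟨j - 2, by omega, by omega⟩)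
      · rw [e1]; exact s3 i hi (by omega)
      · exact h2 i hi hj
      · rw [step i k hi hk hj]
        have ha := h2 k (by omega) hj
        exact K.mul_mem (K.mul_mem ha (ih k (by omega) i hi (by omega) (by omega))) (K.inv_mem ha)
  refine (Subgroup.closure_le _).2 ?_
  rintro _ ⟨i, j, hi, hij, hj, rfl⟩
  exact all j i hi hij hj

/-! ### The Burau representation over F_7 and the colouring fixed by `E n`. -/

/-- Burau's transformation of a colouring at position `i`, with parameter `3` over `ZMod 7`: the
parameter is a root of `t ^ 2 - t + 1`. -/
def twist (i : ℕ) (f : ℕ → ZMod 7) : ℕ → ZMod 7 := fun k =>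
  if k = i then -2 * f i + 3 * f (i + 1) else if k = i + 1 then f i else f k

/-- The inverse of `twist`. -/
def untwist (i : ℕ) (f : ℕ → ZMod 7) : ℕ → ZMod 7 := fun k =>
  if k = i then f (i + 1) else if k = i + 1 then 5 * (f i + 2 * f (i + 1)) else f k

theorem seven_eq_zero : (7 : ZMod 7) = 0 := by decide

/-- `twist` as a permutation. -/
def twistPerm (i : ℕ) : Equiv.Perm (ℕ → ZMod 7) where
  toFun := twist i
  invFun := untwist i
  left_inv f := by
    funext k
    simp only [untwist, twist]
    split_ifs <;> simp_all
    linear_combination (2 * f (i + 1)) * seven_eq_zero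
  right_inv f := by
    funext k
    simp only [untwist, twist]
    split_ifs <;> simp_all
    linear_combination (2 * f i + 4 * f (i + 1)) * seven_eq_zero

theorem twist_braid (i : ℕ) :
    twistPerm i * twistPerm (i + 1) * twistPerm i =
      twistPerm (i + 1) * twistPerm i * twistPerm (i + 1) := by
  refine Equiv.ext fun f => funext fun k => ?_
  simp only [Equiv.Perm.mul_apply, twistPerm, Equiv.coe_fn_mk, twist]
  have n1 : i + 1 + 1 ≠ i := by omega
  have n2 : i ≠ i + 1 + 1 := by omega
  by_cases h1 : k = i
  · subst h1; simp [n1, n2]; ring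
  by_cases h2 : k = i + 1
  · subst h2; simp [n2]; exact fun h => absurd h n1
  by_cases h3 : k = i + 1 + 1
  · subst h3; simp [n1]; exact fun h => absurd h n2
  · simp [h1, h2, h3]

theorem twist_comm {i j : ℕ} (h : i + 1 < j) :
    twistPerm i * twistPerm j = twistPerm j * twistPerm i := by
  refine Equiv.ext fun f => funext fun k => ?_
  simp only [Equiv.Perm.mul_apply, twistPerm, Equiv.coe_fn_mk, twist]
  have h1 : i ≠ j := by omega
  have h2 : i ≠ j + 1 := by omega
  have h3 : i + 1 ≠ j := by omega
  have h4 : i + 1 ≠ j + 1 := by omega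
  by_cases a1 : k = i
  · subst a1; simp [h1, h2, h3]
  by_cases a2 : k = i + 1
  · subst a2; simp [h1, h2, h3]
  by_cases a3 : k = j
  · subst a3; simp [a1, a2, h2.symm]
  by_cases a4 : k = j + 1
  · subst a4; simp [a1, h1.symm, h3.symm]
  · simp [a1, a2, a3, a4]

/-- The Burau representation at a sixth root of unity. -/
def burau (n : ℕ) : Br n →* Equiv.Perm (ℕ → ZMod 7) :=
  PresentedGroup.toGroup (f := fun g : Gen n => twistPerm g.1) (by
    rintro r (⟨i, j, h, rfl⟩ | ⟨i, j, h, rfl⟩)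
    · simp only [map_mul, map_inv, FreeGroup.lift_apply_of, mul_inv_eq_one, ← h]
      exact twist_braid _
    · simp only [map_mul, map_inv, FreeGroup.lift_apply_of, mul_inv_eq_one]
      exact twist_comm h)

theorem burau_sigma {n i : ℕ} (hi : 1 ≤ i) (h : i < n) : burau n (sigma n i) = twistPerm i := by
  simp [sigma, hi, h, burau]

/-- The alternating colouring. -/
def alternating : ℕ → ZMod 7 := fun k => if k % 2 = 0 then 0 else 1

/-- Each inverse twist copies the entry at position j + 1 to position j. The colour at the far end
of the arc thus travels down to i + 1, while the entry at i is untouched. -/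
theorem burau_descProd_inv {n i j : ℕ} (hij : i < j) (hj : j ≤ n) (f : ℕ → ZMod 7) :
    (burau n (descProd n i j))⁻¹ f i = f i ∧ (burau n (descProd n i j))⁻¹ f (i + 1) = f j := by
  induction j, hij using Nat.le_induction generalizing f with
  | base => simp [descProd_self]
  | succ j hij ih =>
    have hij' : i + 1 ≤ j := hij
    rw [descProd_succ n hij', map_mul, mul_inv_rev, Equiv.Perm.mul_apply,
      burau_sigma (by omega) (by omega)]
    obtain ⟨h1, h2⟩ := ih (by omega) ((twistPerm j)⁻¹ f)
    rw [h1, h2]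
    have h3 : i ≠ j := by omega
    have h4 : i ≠ j + 1 := by omega
    have : ∀ k, (twistPerm j)⁻¹ f k = untwist j f k := fun k => rfl
    simp [this, untwist, h3, h4]

theorem twist_eq_self {i : ℕ} {f : ℕ → ZMod 7} (h : f i = f (i + 1)) : twist i f = f := by
  funext k
  unfold twist
  split_ifs with h1 h2
  · rw [h1, h]; ring
  · rw [h2, h]
  · rfl

/-- The twist has eigenvalues 1 and -3, and (-3)^3 = 1 in F_7. -/
theorem twistPerm_pow_three (i : ℕ) : twistPerm i ^ 3 = 1 := by
  refine Equiv.ext fun f => funext fun k => ?_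
  simp only [pow_succ, pow_zero, one_mul, Equiv.Perm.mul_apply, twistPerm, Equiv.coe_fn_mk, twist,
    Equiv.Perm.one_apply]
  by_cases h1 : k = i
  · subst h1
    simp
    linear_combination (-3 * f k + 3 * f (k + 1)) * seven_eq_zero
  by_cases h2 : k = i + 1
  · subst h2
    simp
    linear_combination (f i - f (i + 1)) * seven_eq_zero
  · simp [h1, h2]

/-- After undoing the conjugation the colours of i and j sit side by side. If the indices have the
same parity the colours agree and the twist fixes them; otherwise the exponent is 3 and the power is
trivial. -/
theorem burau_e {n i j : ℕ} (hi : 1 ≤ i) (hij : i < j) (hj : j ≤ n) :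
    burau n (e n i j) alternating = alternating := by
  rw [e, map_mul, map_mul, map_inv, Equiv.Perm.mul_apply, Equiv.Perm.mul_apply]
  obtain ⟨h1, h2⟩ := burau_descProd_inv hij hj alternating
  set g := (burau n (descProd n i j))⁻¹ alternating with hg
  have key : (burau n (sigma n i ^ m i j)) g = g := by
    rw [map_pow, burau_sigma hi (by omega), m]
    split_ifs with hm
    · rw [pow_one]
      refine twist_eq_self ?_
      rw [h1, h2]
      simp [alternating, hm]
    · rw [twistPerm_pow_three, Equiv.Perm.one_apply]
  rw [key, hg]
  exact Equiv.apply_symm_apply _ _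

theorem burau_of_mem_E {n : ℕ} {β : Br n} (h : β ∈ E n) :
    burau n β alternating = alternating := by
  have : E n ≤ (MulAction.stabilizer (Equiv.Perm (ℕ → ZMod 7)) alternating).comap (burau n) := by
    refine (Subgroup.closure_le _).2 ?_
    rintro _ ⟨i, j, hi, hij, hj, rfl⟩
    exact burau_e hi hij hj
  exact this h

/-- If a conjugate of `σ_1` lies in `E_n`, then the transported colouring has equal first entries. -/
theorem burau_of_conj_mem_E {n : ℕ} (hn : 2 ≤ n) {r : Br n} (h : r⁻¹ * sigma n 1 * r ∈ E n) :
    burau n r alternating 1 = burau n r alternating 2 := by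
  have h1 := burau_of_mem_E h
  rw [map_mul, map_mul, map_inv, Equiv.Perm.mul_apply, Equiv.Perm.mul_apply,
    Equiv.Perm.inv_eq_iff_eq, burau_sigma le_rfl (by omega)] at h1
  -- Entry 2 is the one to compare: there the twist writes the old entry 1.
  have h2 : twist 1 (burau n r alternating) 2 = burau n r alternating 2 := congrFun h1 2
  simpa [twist] using h2

/-! ### Words for the relators and for the generators of `E n`. -/

/-- The letters used for scanning: `0` codes `δ`, and `2 * i` codes `σ_i`. -/
def scanGen (n : ℕ) (i : ℕ) : Br n := if i = 0 then delta n else sigma n i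

theorem letterVal_even (n : ℕ) {i : ℕ} (hi : 1 ≤ i) :
    letterVal (scanGen n) (2 * i) = sigma n i := by
  have : i ≠ 0 := by omega
  simp [letterVal, scanGen, this]

theorem letterVal_odd (n : ℕ) {i : ℕ} (hi : 1 ≤ i) :
    letterVal (scanGen n) (2 * i + 1) = (sigma n i)⁻¹ := by
  have h1 : i ≠ 0 := by omega
  have h2 : (2 * i + 1) / 2 = i := by omega
  simp [letterVal, scanGen, h1, h2]

@[simp] theorem letterVal_zero (n : ℕ) : letterVal (scanGen n) 0 = delta n := rfl

@[simp] theorem letterVal_one (n : ℕ) : letterVal (scanGen n) 1 = (delta n)⁻¹ := rfl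

/-- The word of `descProd`. -/
def descWord (i j : ℕ) : List ℕ := (List.range' (i + 1) (j - (i + 1))).reverse.map (2 * ·)

/-- The word of `e_{ij}`. -/
def eWord (i j : ℕ) : List ℕ :=
  descWord i j ++ List.replicate (m i j) (2 * i) ++ invWord (descWord i j)

/-- The words of the generators of `E_n`. -/
def eWords (n : ℕ) : List (List ℕ) :=
  (List.range' 1 (n - 1)).flatMap fun i =>
    (List.range' (i + 1) (n - i)).map fun j => eWord i j

/-- Words representing `1` in `Br_n`. -/
def relWords (n : ℕ) : List (List ℕ) :=
  (List.range' 1 (n - 2)).map (fun i =>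
    [2 * i, 2 * (i + 1), 2 * i, 2 * (i + 1) + 1, 2 * i + 1, 2 * (i + 1) + 1]) ++
  ((List.range' 1 (n - 1)).flatMap fun i =>
    (List.range' (i + 2) (n - (i + 2))).map fun j => [2 * i, 2 * j, 2 * i + 1, 2 * j + 1]) ++
  (List.range' 1 (n - 2)).map (fun i => [2 * i, 0, 2 * (i + 1) + 1, 1]) ++
  [0 :: invWord (descWord 0 n)]

theorem wordVal_descWord (n i j : ℕ) : wordVal (scanGen n) (descWord i j) = descProd n i j := by
  simp only [wordVal, descWord, descProd, List.map_map]
  congr 1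
  refine List.map_congr_left fun k hk => ?_
  simp only [List.mem_reverse, List.mem_range'_1] at hk
  exact letterVal_even n (by omega)

theorem wordVal_eWord (n j : ℕ) {i : ℕ} (hi : 1 ≤ i) :
    wordVal (scanGen n) (eWord i j) = e n i j := by
  have : wordVal (scanGen n) (List.replicate (m i j) (2 * i)) = sigma n i ^ m i j := by
    simp [wordVal, letterVal_even n hi]
  rw [eWord, wordVal_append, wordVal_append, wordVal_invWord, wordVal_descWord, this, e]

theorem wordVal_mem_of_mem_eWords {n : ℕ} {w : List ℕ} (hw : w ∈ eWords n) :
    wordVal (scanGen n) w ∈ E n := by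
  simp only [eWords, List.mem_flatMap, List.mem_map, List.mem_range'_1] at hw
  obtain ⟨i, hi, j, hj, rfl⟩ := hw
  rw [wordVal_eWord n j hi.1]
  exact e_mem_E hi.1 (by omega) (by omega)

theorem wordVal_of_mem_relWords {n : ℕ} {w : List ℕ} (hw : w ∈ relWords n) :
    wordVal (scanGen n) w = 1 := by
  simp only [relWords, List.mem_append, List.mem_flatMap, List.mem_map, List.mem_range'_1,
    List.mem_singleton] at hw
  obtain ((⟨i, hi, rfl⟩ | ⟨i, hi, j, hj, rfl⟩) | ⟨i, hi, rfl⟩) | rfl := hw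
  · have := sigma_braid (n := n) hi.1 (by omega)
    simp only [wordVal_cons, wordVal_nil, letterVal_even n hi.1, letterVal_odd n hi.1,
      letterVal_even n (Nat.le_add_left 1 i), letterVal_odd n (Nat.le_add_left 1 i), mul_one]
    simp only [← mul_assoc]
    rw [this]
    simp
  · have := (sigma_comm (n := n) (i := i) (j := j) (by omega)).eq
    have hj1 : 1 ≤ j := by omega
    simp only [wordVal_cons, wordVal_nil, letterVal_even n hi.1, letterVal_odd n hi.1,
      letterVal_even n hj1, letterVal_odd n hj1, mul_one]
    simp only [← mul_assoc]
    rw [this]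
    simp
  · have := sigma_mul_delta (n := n) hi.1 (by omega)
    simp only [wordVal_cons, wordVal_nil, letterVal_even n hi.1,
      letterVal_odd n (Nat.le_add_left 1 i), letterVal_zero, letterVal_one, mul_one]
    simp only [← mul_assoc]
    rw [this]
    simp
  · rw [wordVal_cons, wordVal_invWord, wordVal_descWord, letterVal_zero, delta, mul_inv_cancel]

/-! ### Connecting words in the centraliser of σ_1, and the colour test. -/

/-- The elements of the centraliser of `σ_1` used to connect nodes. -/
def isCentral (b : List ℕ) : Bool :=
  b == [4, 2, 2, 4] || b == [5, 3, 3, 5] ||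
    match b with
    | [c] => c == 2 || c == 3 || Nat.ble 6 c
    | _ => false

/-- Geometrically σ_2 σ_1² σ_2 carries the third strand around the first two, which does not disturb
their half twist. -/
theorem commute_push (n : ℕ) (hn : 3 ≤ n) :
    Commute (sigma n 2 * (sigma n 1 * (sigma n 1 * sigma n 2))) (sigma n 1) := by
  have h : sigma n 1 * sigma n 2 * sigma n 1 = sigma n 2 * sigma n 1 * sigma n 2 :=
    sigma_braid le_rfl (by omega)
  generalize sigma n 1 = a at *
  generalize sigma n 2 = b at *
  calc b * (a * (a * b)) * a = b * a * (a * b * a) := by simp only [mul_assoc]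
    _ = (b * a * b) * (a * b) := by rw [h]; simp only [mul_assoc]
    _ = a * (b * (a * (a * b))) := by rw [← h]; simp only [mul_assoc]

theorem commute_of_isCentral {n : ℕ} (hn : 3 ≤ n) {b : List ℕ} (hb : isCentral b = true) :
    Commute (wordVal (scanGen n) b) (sigma n 1) := by
  have l2 : letterVal (scanGen n) 2 = sigma n 1 := letterVal_even n le_rfl
  have l3 : letterVal (scanGen n) 3 = (sigma n 1)⁻¹ := letterVal_odd n le_rfl
  have l4 : letterVal (scanGen n) 4 = sigma n 2 := letterVal_even n (i := 2) (by norm_num)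
  have l5 : letterVal (scanGen n) 5 = (sigma n 2)⁻¹ := letterVal_odd n (i := 2) (by norm_num)
  simp only [isCentral, Bool.or_eq_true, beq_iff_eq] at hb
  rcases hb with (rfl | rfl) | hb
  · simpa [l2, l4] using commute_push n hn
  · have := (commute_push n hn).inv_left
    simpa [l3, l5, mul_assoc] using this
  · split at hb
    swap
    · simp at hb
    rename_i c
    simp only [Bool.or_eq_true, beq_iff_eq, Nat.ble_eq] at hb
    rcases hb with (rfl | rfl) | hb
    · simp [l2]
    · simp [l3]
    · rw [wordVal_cons, wordVal_nil, mul_one]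
      rcases Nat.mod_two_eq_zero_or_one c with h | h
      · obtain ⟨d, rfl⟩ : ∃ d, c = 2 * d := ⟨c / 2, by omega⟩
        rw [letterVal_even n (by omega)]
        exact (sigma_comm (by omega)).symm
      · obtain ⟨d, rfl⟩ : ∃ d, c = 2 * d + 1 := ⟨c / 2, by omega⟩
        rw [letterVal_odd n (by omega)]
        exact (sigma_comm (by omega)).symm.inv_left

/-- Burau's action of a word in the `σ_i` on colourings. -/
def colour : List ℕ → (ℕ → ZMod 7) → ℕ → ZMod 7
  | [], f => f
  | c :: w, f => if c % 2 = 0 then twist (c / 2) (colour w f) else untwist (c / 2) (colour w f)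

/-- The bounds exclude the codes 0 and 1 of δ^{±1}, which `colour` does not interpret, and the codes
of generators outside the range. -/
theorem burau_wordVal {n : ℕ} (f : ℕ → ZMod 7) (w : List ℕ)
    (hw : w.all (fun c => Nat.ble 2 c && Nat.blt c (2 * n)) = true) :
    burau n (wordVal (scanGen n) w) f = colour w f := by
  induction w with
  | nil => simp [colour]
  | cons c w ih =>
    simp only [List.all_cons, Bool.and_eq_true, Nat.ble_eq, Nat.blt_eq] at hw
    rw [wordVal_cons, map_mul, Equiv.Perm.mul_apply, ih hw.2, colour]
    have h0 : c / 2 ≠ 0 := by omega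
    rw [letterVal, scanGen, if_neg h0]
    split_ifs with h
    · rw [burau_sigma (by omega) (by omega)]; rfl
    · rw [map_inv, burau_sigma (by omega) (by omega)]; rfl

/-- The word `w` moves the alternating colouring to one with different first entries. -/
def moved (n : ℕ) (w : List ℕ) : Bool :=
  w.all (fun c => Nat.ble 2 c && Nat.blt c (2 * n)) &&
    decide (colour w alternating 1 ≠ colour w alternating 2)

theorem not_mem_of_moved {n : ℕ} (hn : 2 ≤ n) {w : List ℕ} (h : moved n w = true) :
    (wordVal (scanGen n) w)⁻¹ * sigma n 1 * wordVal (scanGen n) w ∉ E n := by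
  intro hw
  simp only [moved, Bool.and_eq_true, decide_eq_true_eq] at h
  have := burau_of_conj_mem_E hn hw
  rw [burau_wordVal _ _ h.1] at this
  exact h.2 this

/-! ### From a complete table to the theorem. -/

/-- A complete table: all `σ_i ^ ±1` are defined at all nodes, all nodes are coloured with different
first entries or joined to node `k₀`, the node of `σ_2⁻¹`, in the centraliser of `σ_1`. -/
noncomputable def complete (n : ℕ) (W : List (List ℕ)) (Z : List (ℕ × List (List ℕ))) (k₀ : ℕ) (F : List Edge) :
    Bool :=
  (W.getD 0 [0] == []) && (W.getD k₀ [] == [5]) &&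
  (List.range W.length).all fun k =>
    ((List.range' 2 (2 * n - 2)).all fun c =>
      match next F c k with
      | none => false
      | some j => Nat.blt j W.length) &&
    (moved n (W.getD k []) || Z.any fun z =>
      (z.1 == k) && z.2.all isCentral && (walk F z.2.flatten.reverse k == (k₀, [])))

/-- Every point is a node if the table is complete. -/
theorem exists_node {n : ℕ} {S : Type*} [MulAction (Br n) S] {x₀ : S} {W : List (List ℕ)}
    {F : List Edge} (hF : Sound (scanGen n) (node (scanGen n) W x₀) F)
    (h0 : node (scanGen n) W x₀ 0 = x₀) (hW : 0 < W.length)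
    (hc : ∀ k < W.length, ∀ c, 2 ≤ c → c < 2 * n → ∃ j < W.length, next F c k = some j) (g : Br n) :
    ∃ k < W.length, g • x₀ = node (scanGen n) W x₀ k := by
  have hg : g ∈ Subgroup.closure {x : Br n | ∃ i, 1 ≤ i ∧ i < n ∧ x = sigma n i} := by
    rw [closure_sigma]; trivial
  induction hg using Subgroup.closure_induction_left with
  | one => exact ⟨0, hW, by rw [one_smul, h0]⟩
  | mul_left x hx y _ ih =>
    obtain ⟨i, hi, hin, rfl⟩ := hx
    obtain ⟨k, hk, hy⟩ := ih
    obtain ⟨j, hj, hn⟩ := hc k hk (2 * i) (by omega) (by omega)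
    refine ⟨j, hj, ?_⟩
    rw [mul_smul, hy, ← hF.next hn, letterVal_even n hi]
  | inv_mul_cancel x hx y _ ih =>
    obtain ⟨i, hi, hin, rfl⟩ := hx
    obtain ⟨k, hk, hy⟩ := ih
    obtain ⟨j, hj, hn⟩ := hc k hk (2 * i + 1) (by omega) (by omega)
    refine ⟨j, hj, ?_⟩
    rw [mul_smul, hy, ← hF.next hn, letterVal_odd n hi]

/-- The double coset argument, with C and the certificate left abstract. Elements of C may be
dropped because conjugation by them preserves `E n` and fixes e_{13}. -/
theorem halfTwist_inter_E {n : ℕ} (hn : 3 ≤ n) (C : Subgroup (Br n))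
    (hC : ∀ c ∈ C, Commute c (e n 1 3)) (hN : C ≤ Subgroup.normalizer (E n : Set (Br n)))
    {W : List (List ℕ)} {Z : List (ℕ × List (List ℕ))} {k₀ : ℕ} {F : List Edge}
    {R H : List (List ℕ)} (hcheck : check W R H F = true) (hcomplete : complete n W Z k₀ F = true)
    (hR : ∀ w ∈ R, ∀ x : Br n ⧸ (E n ⊔ C), wordVal (scanGen n) w • x = x)
    (hH : ∀ w ∈ H, wordVal (scanGen n) w ∈ E n ⊔ C) :
    {β : Br n | IsHalfTwist β} ∩ (E n : Set (Br n)) =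
      {β : Br n | ∃ g ∈ E n, β = g⁻¹ * e n 1 3 * g} := by
  have h13 := e_one_three n
  apply Set.Subset.antisymm
  swap
  · rintro _ ⟨g, hg, rfl⟩
    refine ⟨⟨1, le_rfl, by omega, (sigma n 2)⁻¹ * g, ?_⟩, ?_⟩
    · rw [h13]; simp only [mul_inv_rev, inv_inv, mul_assoc]
    · exact (E n).mul_mem ((E n).mul_mem ((E n).inv_mem hg) (e_mem_E le_rfl (by omega) hn)) hg
  rintro β ⟨⟨i, hi, hin, g₀, rfl⟩, hβ⟩
  obtain ⟨h, hh⟩ := sigma_isConj_one hi hin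
  obtain ⟨g, hg⟩ : ∃ g, g₀⁻¹ * sigma n i * g₀ = g⁻¹ * sigma n 1 * g :=
    ⟨h * g₀, by rw [hh]; simp only [mul_inv_rev, mul_assoc]⟩
  rw [hg] at hβ ⊢
  clear hg hh h g₀ hi hin i
  simp only [complete, Bool.and_eq_true, beq_iff_eq, List.all_eq_true, List.mem_range,
    Bool.or_eq_true, List.any_eq_true] at hcomplete
  obtain ⟨⟨hW0, hWk⟩, hall⟩ := hcomplete
  have hW : 0 < W.length := by
    -- The default `[0]` in `complete` differs from `[]`, so the test at node 0 rules out an empty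
    -- table.
    by_contra hlen
    rw [List.getD_eq_default _ _ (by omega)] at hW0
    simp at hW0
  have hW0' : W.getD 0 [] = [] := by
    rw [List.getD_eq_getElem _ _ hW] at hW0 ⊢
    exact hW0
  set x₀ : Br n ⧸ (E n ⊔ C) := ((1 : Br n) : Br n ⧸ (E n ⊔ C)) with hx₀
  have hmk : ∀ a : Br n, a • x₀ = (a : Br n ⧸ (E n ⊔ C)) := fun a => by
    rw [hx₀, MulAction.Quotient.smul_coe, smul_eq_mul, mul_one]
  have hnode0 : node (scanGen n) W x₀ 0 = x₀ := by
    rw [node, hW0', wordVal_nil, one_smul]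
  have hF : Sound (scanGen n) (node (scanGen n) W x₀) F := by
    refine sound_of_check hR (fun w hw => ?_) hcheck
    rw [hnode0, hmk, hx₀, eq_comm, QuotientGroup.eq]
    simpa using hH w hw
  obtain ⟨k, hk, hgk⟩ := exists_node hF hnode0 hW (by
    intro k hk c hc1 hc2
    have := (hall k hk).1 c (List.mem_range'_1.2 ⟨hc1, by omega⟩)
    split at this
    · simp at this
    · rename_i j hj
      exact ⟨j, by simpa using this, hj⟩) g
  have mulEC : ∀ y ∈ E n ⊔ C, ∃ c ∈ C, ∃ a ∈ E n, c * a = y := by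
    intro y hy
    rw [sup_comm, ← SetLike.mem_coe, Subgroup.coe_mul_of_left_le_normalizer_right C (E n) hN] at hy
    obtain ⟨c, hc, a, ha, rfl⟩ := hy
    exact ⟨c, hc, a, ha, rfl⟩
  have conjC : ∀ c ∈ C, ∀ x, c⁻¹ * x * c ∈ E n ↔ x ∈ E n := by
    intro c hc x
    have := Subgroup.mem_normalizer_iff''.1 (hN hc) x
    exact this.symm
  set r := wordVal (scanGen n) (W.getD k []) with hr
  rw [node, ← hr, hmk, hmk, eq_comm, QuotientGroup.eq] at hgk
  obtain ⟨c, hc, a, ha, hca⟩ := mulEC _ hgk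
  have hgr : g = r * (c * a) := by rw [hca, mul_inv_cancel_left]
  -- Membership passes from g = r c a to the representative r, since conjugation by a and by c both
  -- preserve `E n`; the colour test then applies to r.
  have hrE : r⁻¹ * sigma n 1 * r ∈ E n := by
    rw [← conjC c hc, ← (E n).mul_mem_cancel_right ha, ← (E n).mul_mem_cancel_left ((E n).inv_mem ha)]
    rw [SetLike.mem_coe, hgr] at hβ
    simpa only [mul_inv_rev, mul_assoc] using hβ
  rcases (hall k hk).2 with hmv | ⟨z, _, ⟨hzk, hz⟩, hwz⟩
  · exact absurd hrE (not_mem_of_moved (by omega) hmv)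
  set ζ := wordVal (scanGen n) z.2.flatten with hζ
  have hcomm : Commute ζ (sigma n 1) := by
    rw [hζ]
    have : ∀ L : List (List ℕ), (∀ b ∈ L, isCentral b = true) →
        Commute (wordVal (scanGen n) L.flatten) (sigma n 1) := by
      intro L hL
      induction L with
      | nil => simp
      | cons b L ih =>
        rw [List.flatten_cons, wordVal_append]
        exact (commute_of_isCentral hn (hL b (by simp))).mul_left (ih fun b hb => hL b (by simp [hb]))
    exact this _ hz
  have hζk := hF.walk_all hwz
  rw [node, node, hWk, hmk, ← hr, ← hζ, MulAction.Quotient.smul_coe, smul_eq_mul, hmk, eq_comm,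
    QuotientGroup.eq] at hζk
  have l5 : wordVal (scanGen n) [5] = (sigma n 2)⁻¹ := by
    rw [wordVal_cons, wordVal_nil, mul_one]
    exact letterVal_odd n (i := 2) (by norm_num)
  rw [l5, inv_inv] at hζk
  obtain ⟨c', hc', a', ha', hca'⟩ := mulEC _ ((E n ⊔ C).mul_mem hζk hgk)
  -- The link says that ζ r and σ_2⁻¹ lie in the same coset of E_n C; this places g in the double
  -- coset of σ_2⁻¹ up to a factor from C.
  have hgz : g = ζ⁻¹ * ((sigma n 2)⁻¹ * (c' * a')) := by
    rw [hca']
    simp [mul_assoc]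
  refine ⟨a', ha', ?_⟩
  have h1 : ζ * sigma n 1 * ζ⁻¹ = sigma n 1 := by rw [hcomm.eq, mul_inv_cancel_right]
  have h2 : c'⁻¹ * e n 1 3 * c' = e n 1 3 := by
    rw [mul_assoc, ← (hC c' hc').eq, inv_mul_cancel_left]
  calc g⁻¹ * sigma n 1 * g
      = a'⁻¹ * (c'⁻¹ * (sigma n 2 * (ζ * sigma n 1 * ζ⁻¹) * (sigma n 2)⁻¹) * c') * a' := by
        rw [hgz]; simp only [mul_inv_rev, inv_inv, mul_assoc]
    _ = a'⁻¹ * e n 1 3 * a' := by rw [h1, ← h13, h2]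

/-! ### Certificates for n = 3, 4, 5, 6. -/

/-- Coset representatives for `n = 3`. -/
def nodesThree : List (List ℕ) :=
  [[], [2], [3], [4], [5], [4, 3], [5, 3], [3, 4]]

/-- Words in the centraliser of `σ_1` joining nodes, `n = 3`. -/
def linksThree : List (ℕ × List (List ℕ)) :=
  [(4, []), (5, [[4, 2, 2, 4]])]

/-- The certified edges for `n = 3`. -/
def edgesThree : List Edge :=
  [(2, 6, 7, 1, 3), (4, 5, 6, 1, 6), (2, 5, 5, 1, 5), (4, 7, 7, 1, 4), (4, 1, 1, 1, 1), (2, 3, 6,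
   1, 0), (4, 3, 4, 6, 0), (2, 4, 4, 5, 0), (2, 1, 2, 4, 0), (2, 7, 3, 0, 0), (4, 6, 2, 0, 0),
   (4, 2, 5, 0, 0), (4, 4, 0, 0, 0), (4, 0, 3, 0, 0), (2, 2, 0, 0, 0), (2, 0, 1, 0, 0)]

/-- Coset representatives for `n = 4`. -/
def nodesFour : List (List ℕ) :=
  [[], [2], [3], [4], [5], [6], [7], [6, 2], [7, 2], [4, 3], [5, 3], [6, 3], [7, 3], [3, 4], [6,
   5], [7, 5], [5, 6], [4, 6, 2], [5, 6, 2], [4, 7, 2], [5, 7, 2], [6, 4, 3], [7, 4, 3], [4, 7,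
   3], [2, 5, 6], [6, 5, 6, 2], [2, 5, 7, 2]]

/-- Words in the centraliser of `σ_1` joining nodes, `n = 4`. -/
def linksFour : List (ℕ × List (List ℕ)) :=
  [(4, []), (9, [[4, 2, 2, 4]]), (14, [[7]]), (15, [[6]]), (18, [[6], [4, 2, 2, 4]]), (19, [[6],
   [4, 2, 2, 4], [6]]), (21, [[4, 2, 2, 4], [7]]), (22, [[4, 2, 2, 4], [6]]), (25, [[6], [4, 2,
   2, 4], [7]])]

/-- The certified edges for `n = 4`. -/
def edgesFour : List Edge :=
  [(2, 24, 17, 1, 17), (6, 25, 19, 2, 19), (6, 21, 22, 2, 9), (4, 24, 24, 1, 24), (2, 26, 23, 1,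
   23), (2, 17, 16, 1, 5), (4, 23, 21, 4, 2), (0, 23, 1, 4, 1), (0, 21, 2, 4, 0), (2, 25, 25, 3,
   25), (2, 18, 18, 3, 18), (4, 25, 25, 2, 25), (6, 23, 23, 2, 23), (4, 17, 18, 2, 18), (4, 22,
   22, 2, 10), (4, 15, 16, 2, 5), (4, 21, 12, 2, 2), (4, 26, 26, 1, 26), (4, 19, 20, 1, 20), (2,
   19, 19, 1, 19), (4, 11, 11, 1, 15), (2, 23, 20, 1, 8), (2, 10, 13, 1, 3), (0, 12, 0, 6, 0),
   (6, 26, 26, 3, 26), (6, 24, 24, 3, 24), (2, 21, 21, 3, 21), (2, 14, 14, 3, 14), (2, 7, 11, 3,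
   11), (6, 10, 10, 3, 10), (2, 22, 22, 3, 9), (6, 7, 8, 3, 8), (2, 5, 7, 3, 7), (6, 11, 12, 3,
   6), (2, 11, 5, 3, 5), (2, 15, 15, 3, 4), (6, 13, 13, 3, 3), (2, 8, 12, 3, 2), (2, 6, 8, 3, 1),
   (2, 12, 6, 3, 0), (6, 17, 17, 2, 17), (6, 14, 15, 2, 15), (4, 14, 14, 2, 14), (6, 19, 18, 2,
   7), (6, 16, 16, 2, 6), (6, 3, 3, 2, 3), (6, 20, 20, 2, 1), (4, 5, 15, 2, 0), (4, 9, 10, 1,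
   10), (2, 9, 9, 1, 9), (4, 13, 13, 1, 4), (4, 1, 1, 1, 1), (2, 3, 10, 1, 0), (6, 5, 6, 12, 0),
   (4, 6, 6, 11, 0), (4, 3, 4, 10, 0), (2, 4, 4, 8, 0), (2, 1, 2, 7, 0), (2, 20, 26, 0, 0), (6,
   18, 25, 0, 0), (2, 16, 24, 0, 0), (4, 12, 23, 0, 0), (6, 22, 9, 0, 0), (6, 9, 21, 0, 0), (4,
   20, 8, 0, 0), (4, 8, 19, 0, 0), (4, 18, 7, 0, 0), (4, 7, 17, 0, 0), (4, 16, 5, 0, 0), (6, 15,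
   4, 0, 0), (6, 4, 14, 0, 0), (2, 13, 3, 0, 0), (6, 12, 2, 0, 0), (6, 2, 11, 0, 0), (4, 10, 2,
   0, 0), (4, 2, 9, 0, 0), (6, 8, 1, 0, 0), (6, 1, 7, 0, 0), (6, 6, 0, 0, 0), (6, 0, 5, 0, 0),
   (4, 4, 0, 0, 0), (4, 0, 3, 0, 0), (2, 2, 0, 0, 0), (2, 0, 1, 0, 0)]

/-- Coset representatives for `n = 5`. -/
def nodesFive : List (List ℕ) :=
  [[], [2], [3], [4], [5], [6], [7], [8], [9], [6, 2], [7, 2], [8, 2], [9, 2], [4, 3], [5, 3],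
   [6, 3], [7, 3], [8, 3], [9, 3], [3, 4], [8, 4], [6, 5], [7, 5], [8, 5], [9, 5], [5, 6], [9,
   7], [7, 8], [4, 6, 2], [5, 6, 2], [7, 8, 2], [6, 4, 3], [7, 4, 3], [8, 4, 3], [8, 5, 3], [7,
   8, 3], [8, 6, 5], [9, 6, 5], [2, 5, 6], [4, 7, 8]]

/-- Words in the centraliser of `σ_1` joining nodes, `n = 5`. -/
def linksFive : List (ℕ × List (List ℕ)) :=
  [(4, []), (13, [[4, 2, 2, 4]]), (21, [[7]]), (22, [[6]]), (23, [[9]]), (24, [[8]]), (29, [[6],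
   [4, 2, 2, 4]]), (31, [[8], [4, 2, 2, 4]]), (32, [[4, 2, 2, 4], [6]]), (33, [[9], [4, 2, 2,
   4]]), (36, [[7], [9]]), (37, [[7], [8]])]

/-- The certified edges for `n = 5`. -/
def edgesFive : List Edge :=
  [(8, 32, 32, 3, 33), (8, 19, 26, 3, 26), (2, 34, 26, 1, 20), (2, 39, 39, 1, 39), (6, 24, 29,
   10, 29), (6, 29, 36, 10, 37), (8, 33, 31, 6, 16), (4, 18, 31, 6, 13), (4, 8, 10, 6, 3), (8,
   31, 13, 6, 14), (4, 10, 24, 6, 4), (4, 16, 18, 6, 2), (6, 33, 33, 2, 34), (4, 30, 27, 2, 20),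
   (4, 35, 35, 2, 17), (4, 39, 30, 2, 30), (6, 34, 35, 4, 35), (6, 17, 34, 4, 34), (6, 11, 20, 4,
   20), (6, 20, 30, 4, 30), (8, 34, 16, 5, 16), (2, 26, 20, 5, 10), (8, 6, 19, 5, 3), (8, 16, 14,
   5, 14), (8, 10, 3, 9, 15), (8, 20, 10, 9, 2), (0, 38, 37, 11, 21), (0, 10, 2, 11, 16), (0, 6,
   29, 8, 29), (6, 31, 32, 2, 13), (4, 32, 32, 2, 14), (2, 38, 28, 7, 28), (4, 38, 38, 1, 38),
   (8, 30, 30, 3, 12), (6, 37, 37, 3, 21), (8, 35, 35, 3, 18), (8, 36, 37, 9, 21), (0, 36, 4, 9,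
   4), (0, 37, 21, 9, 22), (4, 37, 37, 6, 21), (8, 29, 29, 6, 9), (8, 39, 39, 6, 39), (2, 35, 27,
   4, 7), (2, 30, 35, 4, 17), (6, 12, 12, 4, 18), (6, 38, 38, 4, 38), (6, 19, 19, 4, 3), (2, 32,
   32, 4, 13), (6, 18, 18, 4, 8), (2, 31, 31, 4, 31), (2, 27, 30, 4, 11), (8, 9, 9, 5, 9), (8,
   11, 12, 5, 18), (8, 28, 28, 5, 25), (8, 38, 38, 5, 38), (8, 15, 15, 5, 5), (0, 5, 28, 7, 25),
   (0, 25, 38, 7, 38), (0, 3, 15, 7, 5), (0, 20, 16, 7, 16), (0, 7, 10, 7, 10), (6, 39, 39, 2,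
   39), (6, 14, 14, 2, 2), (4, 36, 36, 2, 8), (6, 28, 28, 2, 28), (4, 21, 21, 2, 22), (4, 31, 16,
   2, 16), (6, 26, 27, 3, 7), (8, 22, 22, 3, 23), (6, 36, 24, 3, 24), (8, 25, 25, 10, 25), (6,
   21, 22, 8, 25), (4, 28, 29, 1, 9), (4, 22, 25, 1, 25), (2, 28, 25, 1, 5), (4, 13, 14, 1, 14),
   (4, 33, 34, 1, 34), (0, 21, 22, 8, 22), (0, 22, 25, 8, 5), (0, 16, 7, 10, 7), (0, 23, 6, 10,
   6), (0, 4, 5, 10, 5), (0, 2, 20, 10, 20), (2, 33, 33, 1, 33), (2, 14, 19, 1, 3), (4, 12, 12,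
   1, 12), (4, 19, 19, 1, 4), (2, 13, 13, 1, 13), (4, 11, 11, 1, 17), (2, 20, 34, 1, 7), (4, 1,
   1, 1, 2), (2, 29, 29, 1, 15), (4, 15, 15, 1, 22), (2, 3, 14, 1, 0), (6, 3, 3, 2, 4), (6, 23,
   23, 2, 26), (6, 25, 25, 2, 6), (4, 5, 22, 2, 0), (8, 27, 27, 3, 8), (8, 5, 5, 3, 5), (6, 7,
   26, 3, 0), (2, 8, 12, 5, 1), (8, 17, 18, 5, 8), (2, 7, 11, 5, 11), (2, 36, 36, 5, 36), (2, 24,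
   24, 5, 4), (2, 37, 37, 5, 21), (2, 23, 23, 5, 23), (2, 11, 17, 5, 17), (2, 17, 7, 5, 7), (2,
   12, 18, 5, 2), (2, 18, 8, 5, 0), (2, 6, 10, 4, 10), (2, 22, 22, 4, 4), (6, 9, 10, 4, 16), (2,
   21, 21, 4, 21), (2, 10, 16, 4, 2), (2, 5, 9, 4, 9), (2, 9, 15, 4, 15), (6, 15, 16, 4, 6), (2,
   15, 5, 4, 5), (2, 16, 6, 4, 0), (4, 17, 33, 6, 33), (8, 23, 24, 6, 8), (4, 20, 23, 6, 23), (4,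
   34, 17, 6, 17), (4, 23, 7, 6, 7), (4, 26, 26, 6, 6), (4, 7, 20, 6, 20), (4, 24, 8, 6, 0), (8,
   7, 8, 21, 0), (6, 8, 8, 20, 0), (6, 5, 6, 19, 0), (4, 6, 6, 17, 0), (4, 3, 4, 16, 0), (2, 4,
   4, 13, 0), (2, 1, 2, 12, 0), (4, 27, 39, 0, 0), (2, 25, 38, 0, 0), (8, 37, 21, 0, 0), (8, 21,
   36, 0, 0), (6, 35, 17, 0, 0), (8, 14, 34, 0, 0), (8, 13, 33, 0, 0), (6, 32, 13, 0, 0), (6, 13,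
   31, 0, 0), (6, 30, 11, 0, 0), (4, 29, 9, 0, 0), (4, 9, 28, 0, 0), (6, 27, 7, 0, 0), (8, 26, 6,
   0, 0), (4, 25, 5, 0, 0), (8, 24, 4, 0, 0), (8, 4, 23, 0, 0), (6, 22, 4, 0, 0), (6, 4, 21, 0,
   0), (8, 3, 20, 0, 0), (2, 19, 3, 0, 0), (8, 18, 2, 0, 0), (8, 2, 17, 0, 0), (6, 16, 2, 0, 0),
   (6, 2, 15, 0, 0), (4, 14, 2, 0, 0), (4, 2, 13, 0, 0), (8, 12, 1, 0, 0), (8, 1, 11, 0, 0), (6,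
   10, 1, 0, 0), (6, 1, 9, 0, 0), (8, 8, 0, 0, 0), (8, 0, 7, 0, 0), (6, 6, 0, 0, 0), (6, 0, 5, 0,
   0), (4, 4, 0, 0, 0), (4, 0, 3, 0, 0), (2, 2, 0, 0, 0), (2, 0, 1, 0, 0)]

/-- Coset representatives for `n = 6`. -/
def nodesSix : List (List ℕ) :=
  [[], [2], [3], [4], [5], [6], [7], [8], [9], [10], [11], [7, 2], [8, 2], [9, 2], [11, 2], [4,
   3], [5, 3], [8, 3], [9, 3], [3, 4], [8, 4], [11, 4], [6, 5], [7, 5], [8, 5], [9, 5], [10, 5],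
   [11, 5], [5, 6], [9, 7], [7, 8], [9, 10], [7, 8, 2], [10, 9, 2], [7, 4, 3], [8, 4, 3], [7, 8,
   3], [8, 6, 5], [9, 6, 5], [4, 7, 8]]

/-- Words in the centraliser of `σ_1` joining nodes, `n = 6`. -/
def linksSix : List (ℕ × List (List ℕ)) :=
  [(4, []), (15, [[4, 2, 2, 4]]), (22, [[7]]), (23, [[6]]), (24, [[9]]), (25, [[8]]), (26,
   [[11]]), (27, [[10]]), (34, [[7], [11]]), (35, [[9], [4, 2, 2, 4]]), (37, [[7], [9]]), (38,
   [[7], [8]])]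

/-- The certified edges for `n = 6`. -/
def edgesSix : List Edge :=
  [(2, 39, 39, 11, 39), (2, 33, 21, 7, 21), (10, 37, 22, 14, 15), (10, 34, 37, 14, 26), (4, 36,
   36, 2, 17), (4, 39, 32, 2, 32), (0, 34, 35, 15, 35), (4, 32, 30, 15, 28), (2, 28, 33, 15, 19),
   (0, 36, 39, 15, 39), (10, 8, 28, 4, 16), (10, 33, 19, 4, 19), (10, 38, 38, 4, 34), (8, 33, 33,
   4, 33), (8, 6, 19, 4, 13), (8, 19, 29, 4, 6), (0, 37, 26, 13, 26), (8, 37, 38, 3, 22), (6, 38,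
   38, 3, 23), (8, 34, 34, 3, 34), (6, 35, 35, 3, 26), (6, 27, 37, 3, 37), (6, 37, 25, 3, 4), (6,
   17, 31, 5, 29), (6, 20, 32, 5, 36), (6, 31, 36, 5, 30), (6, 12, 20, 5, 20), (6, 26, 34, 2,
   15), (6, 24, 24, 2, 29), (6, 25, 27, 2, 27), (6, 39, 39, 2, 39), (2, 16, 19, 1, 3), (2, 21,
   28, 1, 28), (8, 11, 3, 6, 16), (2, 38, 38, 6, 22), (2, 29, 20, 6, 11), (8, 12, 13, 6, 13), (8,
   32, 32, 6, 36), (8, 36, 36, 6, 30), (8, 20, 11, 6, 9), (2, 35, 35, 6, 26), (2, 37, 37, 6, 37),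
   (2, 20, 31, 6, 31), (4, 23, 28, 9, 16), (10, 25, 23, 9, 23), (4, 8, 11, 9, 11), (4, 11, 25, 9,
   25), (10, 26, 27, 9, 27), (10, 39, 39, 9, 39), (10, 18, 21, 9, 21), (4, 33, 33, 9, 33), (4,
   34, 34, 9, 34), (4, 18, 26, 9, 26), (10, 15, 25, 9, 8), (10, 28, 16, 9, 2), (2, 15, 15, 7,
   15), (10, 19, 13, 7, 18), (10, 32, 32, 7, 36), (10, 36, 36, 7, 30), (2, 34, 34, 7, 34), (2,
   11, 9, 7, 9), (10, 3, 18, 7, 8), (2, 14, 5, 7, 2), (8, 26, 15, 8, 16), (8, 17, 18, 8, 18), (4,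
   31, 17, 8, 17), (8, 35, 26, 8, 9), (8, 24, 25, 8, 8), (4, 9, 18, 8, 2), (4, 35, 31, 8, 31),
   (10, 12, 12, 4, 12), (10, 24, 24, 4, 24), (10, 35, 35, 4, 35), (10, 17, 17, 4, 17), (8, 16,
   31, 4, 9), (10, 16, 8, 4, 8), (10, 20, 20, 4, 20), (10, 22, 34, 10, 15), (6, 10, 11, 10, 5),
   (10, 2, 11, 10, 1), (6, 33, 33, 10, 33), (10, 11, 5, 10, 6), (6, 14, 9, 10, 9), (6, 15, 26,
   10, 26), (10, 6, 14, 10, 14), (6, 9, 2, 13, 2), (2, 9, 6, 15, 7), (10, 23, 15, 15, 15), (6, 1,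
   10, 15, 0), (6, 2, 14, 15, 1), (2, 31, 29, 15, 30), (10, 1, 6, 15, 6), (2, 5, 10, 15, 3), (0,
   25, 9, 15, 9), (10, 5, 2, 15, 2), (10, 29, 29, 14, 23), (10, 30, 30, 14, 28), (4, 15, 16, 12,
   16), (0, 22, 15, 12, 15), (0, 30, 28, 12, 5), (8, 9, 16, 32, 0), (4, 17, 35, 8, 35), (4, 25,
   8, 8, 0), (8, 23, 23, 8, 23), (8, 27, 27, 8, 10), (8, 21, 21, 8, 21), (4, 29, 29, 8, 6), (4,
   13, 13, 8, 1), (4, 12, 12, 8, 12), (4, 20, 24, 8, 24), (4, 24, 7, 8, 7), (8, 39, 39, 8, 39),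
   (4, 38, 38, 8, 22), (8, 28, 28, 8, 5), (4, 37, 37, 8, 37), (4, 7, 20, 8, 20), (2, 6, 11, 5,
   1), (6, 16, 16, 5, 16), (2, 30, 32, 5, 12), (2, 36, 30, 5, 7), (2, 32, 36, 5, 17), (2, 22, 22,
   5, 22), (6, 13, 13, 5, 13), (2, 23, 23, 5, 4), (6, 18, 18, 5, 8), (6, 19, 19, 5, 3), (0, 4, 2,
   11, 0), (0, 3, 1, 11, 1), (0, 23, 16, 11, 16), (0, 28, 19, 11, 3), (4, 27, 10, 9, 0), (4, 26,
   9, 9, 9), (4, 14, 14, 9, 1), (4, 21, 27, 9, 4), (4, 10, 21, 9, 3), (0, 8, 6, 13, 6), (0, 31,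
   30, 13, 7), (0, 7, 5, 13, 5), (0, 29, 23, 13, 4), (8, 14, 14, 6, 14), (2, 18, 8, 6, 0), (2, 8,
   13, 6, 1), (2, 13, 18, 6, 2), (2, 7, 12, 6, 12), (2, 24, 24, 6, 24), (2, 17, 7, 6, 7), (2, 12,
   17, 6, 17), (2, 25, 25, 6, 4), (6, 7, 29, 3, 6), (6, 29, 30, 3, 7), (8, 5, 5, 3, 5), (8, 30,
   30, 3, 8), (2, 10, 14, 7, 1), (2, 26, 26, 7, 26), (2, 27, 27, 7, 4), (2, 3, 16, 1, 0), (4, 1,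
   1, 1, 1), (4, 19, 19, 1, 4), (0, 6, 4, 12, 4), (0, 5, 3, 12, 3), (10, 31, 31, 4, 10), (10, 7,
   7, 4, 7), (6, 21, 21, 10, 3), (0, 9, 7, 14, 7), (6, 22, 23, 2, 23), (6, 28, 28, 2, 6), (4, 22,
   22, 2, 22), (4, 5, 23, 2, 4), (6, 3, 3, 2, 3), (0, 0, 0, 31, 0), (10, 9, 10, 30, 0), (8, 10,
   10, 29, 0), (8, 7, 8, 28, 0), (6, 8, 8, 26, 0), (6, 5, 6, 25, 0), (4, 6, 6, 22, 0), (4, 3, 4,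
   21, 0), (2, 4, 4, 17, 0), (2, 1, 2, 16, 0), (4, 30, 39, 0, 0), (8, 38, 22, 0, 0), (8, 22, 37,
   0, 0), (6, 36, 17, 0, 0), (8, 15, 35, 0, 0), (6, 34, 15, 0, 0), (10, 13, 33, 0, 0), (6, 32,
   12, 0, 0), (8, 31, 9, 0, 0), (6, 30, 7, 0, 0), (8, 29, 6, 0, 0), (4, 28, 5, 0, 0), (10, 27, 4,
   0, 0), (10, 4, 26, 0, 0), (8, 25, 4, 0, 0), (8, 4, 24, 0, 0), (6, 23, 4, 0, 0), (6, 4, 22, 0,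
   0), (10, 21, 3, 0, 0), (8, 3, 20, 0, 0), (2, 19, 3, 0, 0), (8, 18, 2, 0, 0), (8, 2, 17, 0, 0),
   (4, 16, 2, 0, 0), (4, 2, 15, 0, 0), (10, 14, 1, 0, 0), (8, 13, 1, 0, 0), (8, 1, 12, 0, 0), (6,
   11, 1, 0, 0), (10, 10, 0, 0, 0), (10, 0, 9, 0, 0), (8, 8, 0, 0, 0), (8, 0, 7, 0, 0), (6, 6, 0,
   0, 0), (6, 0, 5, 0, 0), (4, 4, 0, 0, 0), (4, 0, 3, 0, 0), (2, 2, 0, 0, 0), (2, 0, 1, 0, 0)]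

theorem check_three : check nodesThree (relWords 3) (eWords 3) edgesThree = true := by
  decide +kernel

theorem complete_three : complete 3 nodesThree linksThree 4 edgesThree = true := by
  decide +kernel

theorem check_four : check nodesFour (relWords 4) (eWords 4) edgesFour = true := by
  decide +kernel

theorem complete_four : complete 4 nodesFour linksFour 4 edgesFour = true := by
  decide +kernel

/-- The added relator is δ^5: being central and in C, it acts trivially on all cosets. -/
theorem check_five :
    check nodesFive (relWords 5 ++ [[0, 0, 0, 0, 0]]) (eWords 5) edgesFive = true := by
  decide +kernel

theorem complete_five : complete 5 nodesFive linksFive 4 edgesFive = true := by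
  decide +kernel

/-- The two added words, δ and `push`, lie in `E 6 ⊔ pushSubgroup` and so are loops at the base node
only. -/
theorem check_six :
    check nodesSix (relWords 6) (eWords 6 ++ [[0], [0, 2, 4, 6, 8, 10]]) edgesSix = true := by
  decide +kernel

theorem complete_six : complete 6 nodesSix linksSix 4 edgesSix = true := by
  decide +kernel

/-! ### Membership certificates for `E 6`. -/

/-- Some cosets of `E_6` in `Br_6`. -/
def nodesStab : List (List ℕ) :=
  [[], [2], [4], [6], [8], [10], [0], [3], [5], [7], [9], [11], [1], [6, 2], [8, 2], [10, 2], [0,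
   2], [7, 2], [9, 2], [1, 2], [2, 4], [8, 4], [10, 4], [0, 4], [3, 4], [9, 4], [10, 6], [6, 8],
   [1, 8], [8, 10], [3, 10], [5, 0], [9, 0], [9, 3], [1, 3], [1, 5], [8, 7], [11, 7], [1, 7], [1,
   9], [3, 1], [5, 6, 2], [6, 8, 2], [1, 8, 2], [5, 0, 2], [4, 7, 2], [8, 7, 2], [5, 7, 2], [2,
   1, 2], [10, 2, 4], [0, 2, 4], [9, 2, 4], [7, 8, 4], [8, 10, 4], [9, 3, 4], [6, 9, 4], [7, 9,
   4], [1, 6, 8], [3, 8, 10], [5, 6, 8, 2], [1, 6, 8, 2], [2, 5, 0, 2], [3, 5, 0, 2], [8, 4, 7,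
   2], [5, 8, 7, 2], [8, 10, 2, 4], [7, 0, 2, 4], [6, 9, 2, 4], [6, 9, 3, 4], [7, 9, 3, 4], [2,
   5, 8, 7, 2], [5, 6, 9, 3, 4], [7, 5, 8, 7, 2], [9, 6, 9, 3, 4], [11, 6, 9, 3, 4], [11, 5, 8,
   7, 2]]

/-- Certified edges between cosets of `E_6`. -/
def edgesStab : List Edge :=
  [(8, 74, 74, 4, 66), (8, 75, 75, 4, 59), (8, 61, 48, 4, 47), (8, 68, 66, 14, 66), (0, 6, 12,
   14, 12), (10, 66, 66, 7, 52), (2, 70, 60, 7, 44), (2, 67, 68, 5, 68), (2, 66, 52, 5, 21), (0,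
   13, 38, 12, 38), (10, 70, 62, 7, 62), (10, 64, 61, 7, 61), (10, 48, 47, 7, 47), (8, 64, 59, 8,
   42), (8, 59, 47, 8, 17), (4, 16, 38, 8, 12), (10, 52, 52, 10, 21), (6, 73, 73, 3, 69), (8, 46,
   42, 3, 42), (0, 65, 68, 13, 68), (8, 16, 34, 13, 7), (6, 15, 6, 13, 6), (2, 61, 62, 11, 62),
   (0, 16, 28, 11, 28), (2, 23, 26, 11, 26), (0, 49, 54, 11, 25), (2, 50, 21, 11, 21), (2, 26, 6,
   11, 6), (0, 44, 17, 14, 17), (4, 63, 64, 1, 64), (2, 63, 63, 1, 63), (2, 71, 71, 1, 55), (4,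
   48, 40, 1, 40), (2, 34, 34, 1, 37), (2, 51, 54, 1, 25), (2, 53, 65, 6, 65), (2, 60, 64, 6,
   64), (2, 46, 57, 6, 57), (2, 36, 46, 6, 46), (6, 68, 69, 5, 56), (6, 28, 7, 5, 0), (4, 55, 55,
   2, 55), (4, 72, 72, 2, 46), (4, 45, 47, 2, 17), (10, 60, 44, 15, 44), (0, 30, 25, 15, 25), (0,
   7, 21, 15, 21), (10, 65, 51, 9, 33), (10, 53, 25, 9, 25), (10, 21, 21, 9, 21), (2, 37, 40, 20,
   0), (2, 17, 28, 18, 0), (0, 8, 26, 15, 26), (0, 10, 15, 15, 15), (2, 43, 47, 15, 14), (10, 13,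
   6, 15, 6), (2, 28, 9, 15, 4), (2, 12, 37, 15, 0), (6, 46, 46, 3, 46), (6, 55, 56, 3, 25), (8,
   69, 69, 3, 24), (8, 55, 52, 3, 21), (8, 13, 13, 3, 13), (8, 3, 3, 3, 3), (8, 56, 56, 3, 2),
   (8, 42, 17, 3, 1), (4, 46, 63, 8, 63), (4, 57, 60, 8, 60), (4, 65, 58, 8, 58), (4, 29, 53, 8,
   53), (8, 47, 64, 8, 46), (4, 36, 36, 8, 36), (8, 21, 25, 8, 25), (4, 54, 54, 8, 24), (4, 4,
   21, 8, 21), (4, 51, 33, 8, 7), (4, 10, 25, 8, 2), (4, 18, 18, 8, 1), (4, 28, 43, 9, 43), (10,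
   59, 59, 9, 42), (4, 49, 30, 9, 30), (4, 5, 22, 9, 22), (4, 15, 15, 9, 15), (4, 37, 37, 9, 9),
   (2, 55, 67, 5, 67), (2, 68, 55, 5, 55), (6, 48, 48, 5, 48), (2, 69, 56, 5, 25), (6, 20, 20, 5,
   20), (6, 18, 18, 5, 18), (6, 13, 17, 5, 17), (2, 3, 13, 5, 13), (6, 24, 24, 5, 2), (2, 9, 17,
   5, 1), (0, 51, 66, 13, 50), (8, 43, 60, 13, 42), (6, 32, 32, 13, 32), (8, 28, 57, 13, 27), (8,
   39, 39, 13, 10), (8, 38, 12, 13, 0), (6, 43, 43, 10, 43), (10, 42, 42, 10, 42), (6, 22, 22,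
   10, 22), (6, 29, 29, 10, 10), (6, 37, 11, 10, 0), (2, 22, 49, 7, 49), (10, 14, 14, 7, 14),
   (10, 58, 33, 7, 10), (10, 7, 30, 7, 5), (6, 19, 19, 2, 19), (6, 45, 41, 2, 13), (6, 2, 2, 2,
   2), (6, 47, 47, 2, 1), (10, 4, 4, 4, 4), (10, 29, 10, 4, 0), (10, 19, 43, 14, 14), (0, 11, 32,
   14, 6), (10, 12, 28, 14, 4), (10, 39, 12, 14, 0), (8, 30, 58, 6, 29), (2, 25, 51, 6, 20), (8,
   14, 18, 6, 18), (2, 4, 14, 6, 14), (2, 54, 25, 6, 2), (2, 10, 18, 6, 1), (2, 33, 10, 6, 0),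
   (4, 24, 24, 1, 8), (4, 1, 1, 1, 1), (4, 20, 7, 1, 0), (0, 45, 61, 11, 61), (0, 47, 62, 11,
   44), (2, 31, 31, 11, 31), (2, 6, 23, 11, 23), (4, 35, 35, 11, 8), (4, 12, 19, 11, 1), (4, 34,
   12, 11, 0), (0, 17, 44, 12, 16), (6, 38, 38, 12, 9), (0, 9, 31, 12, 6), (6, 35, 12, 12, 0),
   (10, 5, 11, 30, 0), (8, 11, 11, 29, 0), (8, 4, 10, 28, 0), (6, 10, 10, 26, 0), (6, 3, 9, 25,
   0), (4, 9, 9, 22, 0), (4, 2, 8, 21, 0), (2, 8, 8, 17, 0), (10, 75, 64, 0, 0), (10, 74, 68, 0,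
   0), (8, 73, 68, 0, 0), (6, 72, 64, 0, 0), (4, 71, 68, 0, 0), (2, 64, 70, 0, 0), (6, 69, 54, 0,
   0), (6, 54, 68, 0, 0), (6, 51, 67, 0, 0), (6, 66, 50, 0, 0), (8, 49, 65, 0, 0), (4, 64, 46, 0,
   0), (8, 45, 63, 0, 0), (2, 62, 44, 0, 0), (2, 44, 61, 0, 0), (0, 60, 42, 0, 0), (4, 59, 42, 0,
   0), (2, 58, 29, 0, 0), (0, 57, 27, 0, 0), (6, 56, 25, 0, 0), (6, 25, 55, 0, 0), (8, 54, 24, 0,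
   0), (8, 22, 53, 0, 0), (6, 52, 21, 0, 0), (8, 51, 20, 0, 0), (0, 20, 50, 0, 0), (10, 20, 49,
   0, 0), (2, 19, 48, 0, 0), (4, 47, 17, 0, 0), (8, 17, 46, 0, 0), (4, 17, 45, 0, 0), (4, 44, 16,
   0, 0), (0, 43, 14, 0, 0), (6, 14, 42, 0, 0), (4, 41, 13, 0, 0), (2, 40, 12, 0, 0), (0, 39, 10,
   0, 0), (0, 38, 9, 0, 0), (10, 37, 9, 0, 0), (8, 9, 36, 0, 0), (0, 35, 8, 0, 0), (0, 34, 7, 0,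
   0), (8, 33, 7, 0, 0), (8, 32, 6, 0, 0), (4, 31, 6, 0, 0), (2, 30, 5, 0, 0), (8, 5, 29, 0, 0),
   (0, 28, 4, 0, 0), (6, 4, 27, 0, 0), (10, 3, 26, 0, 0), (8, 25, 2, 0, 0), (2, 24, 2, 0, 0), (0,
   2, 23, 0, 0), (10, 2, 22, 0, 0), (8, 2, 21, 0, 0), (2, 2, 20, 0, 0), (0, 19, 1, 0, 0), (8, 18,
   1, 0, 0), (6, 17, 1, 0, 0), (0, 1, 16, 0, 0), (10, 1, 15, 0, 0), (8, 1, 14, 0, 0), (6, 1, 13,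
   0, 0), (0, 12, 0, 0, 0), (10, 11, 0, 0, 0), (8, 10, 0, 0, 0), (6, 9, 0, 0, 0), (4, 8, 0, 0,
   0), (2, 7, 0, 0, 0), (0, 0, 6, 0, 0), (10, 0, 5, 0, 0), (8, 0, 4, 0, 0), (6, 0, 3, 0, 0), (4,
   0, 2, 0, 0), (2, 0, 1, 0, 0)]

/-- The word of the loop of the last strand around all others, for `n = 6`. -/
def pushWord : List ℕ := [0, 2, 4, 6, 8, 10]

/-- Words whose values are shown to lie in `E_6`. -/
def stabWords : List (List ℕ) :=
  ([eWord 1 2, eWord 1 3, eWord 2 4, eWord 3 5, eWord 4 6].flatMap fun w =>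
    [[1] ++ w ++ [0], [0] ++ w ++ [1]]) ++
  [invWord pushWord ++ eWord 4 6 ++ pushWord, pushWord ++ eWord 4 6 ++ invWord pushWord,
    [0, 0] ++ pushWord ++ [1] ++ pushWord]

theorem check_stab : check nodesStab (relWords 6) (eWords 6) edgesStab = true := by
  decide +kernel

theorem walk_stab :
    (stabWords.all fun w => walk edgesStab w.reverse 0 == (0, [])) = true := by
  decide +kernel

/-- A word lies in `E 6` once its walk from the trivial coset returns there. A partial table
suffices, as only these walks have to close. -/
theorem wordVal_mem_of_mem_stabWords {w : List ℕ} (hw : w ∈ stabWords) :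
    wordVal (scanGen 6) w ∈ E 6 := by
  have hF := sound_of_check (gen := scanGen 6) (x₀ := ((1 : Br 6) : Br 6 ⧸ E 6))
    (fun w hw x => by rw [wordVal_of_mem_relWords hw, one_smul])
    (fun w hw => by
      have h0 : nodesStab.getD 0 [] = [] := rfl
      rw [node, h0, wordVal_nil, one_smul, MulAction.Quotient.smul_coe, smul_eq_mul, mul_one, eq_comm,
        QuotientGroup.eq]
      simpa using wordVal_mem_of_mem_eWords hw) check_stab
  have hww := List.all_eq_true.1 walk_stab w hw
  rw [beq_iff_eq] at hww
  have := hF.walk_all hww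
  have h0 : nodesStab.getD 0 [] = [] := rfl
  rw [node, h0, wordVal_nil, one_smul, MulAction.Quotient.smul_coe, smul_eq_mul, mul_one, eq_comm,
    QuotientGroup.eq] at this
  simpa using this

/-! ### The rotation and the loop `push` normalise `E 6`. -/

theorem e_add_two (n i : ℕ) :
    e n i (i + 2) = sigma n (i + 1) * sigma n i * (sigma n (i + 1))⁻¹ := by
  simp [e, m, descProd]

theorem e_one_two (n : ℕ) : e n 1 2 = sigma n 1 ^ 3 := by
  simp [e, m, descProd]

/-- By `E_le` few conjugates need testing. Both directions are required, because a conjugate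
contained in the subgroup might be a proper part of it. -/
theorem mem_normalizer_E {n : ℕ} {g : Br n}
    (h1 : g * e n 1 2 * g⁻¹ ∈ E n) (h1' : g⁻¹ * e n 1 2 * g ∈ E n)
    (h2 : ∀ i, 1 ≤ i → i + 2 ≤ n → g * e n i (i + 2) * g⁻¹ ∈ E n)
    (h2' : ∀ i, 1 ≤ i → i + 2 ≤ n → g⁻¹ * e n i (i + 2) * g ∈ E n) :
    g ∈ Subgroup.normalizer (E n : Set (Br n)) := by
  rw [e_one_two] at h1 h1'
  have a1 : E n ≤ (E n).comap (MulAut.conj g).toMonoidHom := E_le h1 h2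
  have a2 : E n ≤ (E n).comap (MulAut.conj g⁻¹).toMonoidHom :=
    E_le (by simpa using h1') fun i hi hin => by simpa using h2' i hi hin
  rw [Subgroup.mem_normalizer_iff]
  refine fun x => ⟨fun hx => a1 hx, fun hx => ?_⟩
  have := a2 hx
  simpa [mul_assoc] using this

/-- The loop of the last strand around all others, for `n = 6`. -/
def push : Br 6 := wordVal (scanGen 6) pushWord

theorem wordVal_pushWord : wordVal (scanGen 6) pushWord = push := rfl

theorem push_eq : push = delta 6 * ascProd 6 5 := by
  have h : ∀ i, 1 ≤ i → letterVal (scanGen 6) (2 * i) = sigma 6 i := fun i hi => letterVal_even 6 hi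
  have h1 := h 1 (by norm_num)
  have h2 := h 2 (by norm_num)
  have h3 := h 3 (by norm_num)
  have h4 := h 4 (by norm_num)
  have h5 := h 5 (by norm_num)
  norm_num at h1 h2 h3 h4 h5
  simp [push, pushWord, ascProd, List.range', h1, h2, h3, h4, h5]

/-- Passing δ raises the index by one and passing σ_1 ⋯ σ_5 lowers it again. -/
theorem commute_push_sigma {i : ℕ} (hi : 1 ≤ i) (h : i ≤ 4) : Commute push (sigma 6 i) := by
  rw [push_eq, Commute, SemiconjBy, ← mul_assoc, sigma_mul_delta hi (by omega), mul_assoc, mul_assoc,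
    sigma_mul_ascProd hi (by omega) (by norm_num)]

theorem commute_push_e {i : ℕ} (hi : 1 ≤ i) (h : i ≤ 3) : Commute push (e 6 i (i + 2)) := by
  rw [e_add_two]
  have h1 := commute_push_sigma hi (by omega)
  have h2 := commute_push_sigma (i := i + 1) (by omega) (by omega)
  exact (h2.mul_right h1).mul_right h2.inv_right

theorem delta_mem_normalizer : delta 6 ∈ Subgroup.normalizer (E 6 : Set (Br 6)) := by
  have key : ∀ i j, 1 ≤ i → [1] ++ eWord i j ++ [0] ∈ stabWords → [0] ++ eWord i j ++ [1] ∈ stabWords →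
      (delta 6)⁻¹ * e 6 i j * delta 6 ∈ E 6 ∧ delta 6 * e 6 i j * (delta 6)⁻¹ ∈ E 6 := by
    intro i j hi h1 h2
    have a1 := wordVal_mem_of_mem_stabWords h1
    have a2 := wordVal_mem_of_mem_stabWords h2
    simp only [wordVal_append, wordVal_cons, wordVal_nil, mul_one, letterVal_zero, letterVal_one,
      wordVal_eWord 6 j hi] at a1 a2
    exact ⟨a1, a2⟩
  have k12 := key 1 2 le_rfl (by simp [stabWords]) (by simp [stabWords])
  have ki : ∀ i, 1 ≤ i → i + 2 ≤ 6 → (delta 6)⁻¹ * e 6 i (i + 2) * delta 6 ∈ E 6 ∧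
      delta 6 * e 6 i (i + 2) * (delta 6)⁻¹ ∈ E 6 := by
    intro i hi h
    refine key i (i + 2) hi ?_ ?_
    · obtain rfl | rfl | rfl | rfl : i = 1 ∨ i = 2 ∨ i = 3 ∨ i = 4 := by omega
      all_goals simp [stabWords]
    · obtain rfl | rfl | rfl | rfl : i = 1 ∨ i = 2 ∨ i = 3 ∨ i = 4 := by omega
      all_goals simp [stabWords]
  exact mem_normalizer_E k12.2 k12.1 (fun i hi h => (ki i hi h).2) (fun i hi h => (ki i hi h).1)

/-- `push` commutes with all generators in the small generating set except e_{46}, whose two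
conjugates are certified by the table. -/
theorem push_mem_normalizer : push ∈ Subgroup.normalizer (E 6 : Set (Br 6)) := by
  have h46 : push⁻¹ * e 6 4 6 * push ∈ E 6 := by
    have := wordVal_mem_of_mem_stabWords
      (w := invWord pushWord ++ eWord 4 6 ++ pushWord) (by simp [stabWords])
    simpa only [wordVal_append, wordVal_invWord, wordVal_eWord 6 6 (by norm_num : 1 ≤ 4), wordVal_pushWord]
      using this
  have h46' : push * e 6 4 6 * push⁻¹ ∈ E 6 := by
    have := wordVal_mem_of_mem_stabWords
      (w := pushWord ++ eWord 4 6 ++ invWord pushWord) (by simp [stabWords])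
    simpa only [wordVal_append, wordVal_invWord, wordVal_eWord 6 6 (by norm_num : 1 ≤ 4), wordVal_pushWord]
      using this
  have conj : ∀ x ∈ E 6, Commute push x → push * x * push⁻¹ ∈ E 6 ∧ push⁻¹ * x * push ∈ E 6 := by
    intro x hx hc
    refine ⟨?_, ?_⟩
    · rwa [hc.eq, mul_inv_cancel_right]
    · rwa [mul_assoc, ← hc.eq, inv_mul_cancel_left]
  have k12 := conj (e 6 1 2) (e_mem_E le_rfl (by norm_num) (by norm_num)) (by
    rw [e_one_two]; exact (commute_push_sigma le_rfl (by norm_num)).pow_right 3)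
  have ki : ∀ i, 1 ≤ i → i + 2 ≤ 6 → push * e 6 i (i + 2) * push⁻¹ ∈ E 6 ∧
      push⁻¹ * e 6 i (i + 2) * push ∈ E 6 := by
    intro i hi h
    rcases Nat.lt_or_ge 3 i with h3 | h3
    · obtain rfl : i = 4 := by omega
      exact ⟨h46', h46⟩
    · exact conj _ (e_mem_E hi (by omega) h) (commute_push_e hi h3)
  exact mem_normalizer_E k12.1 k12.2 (fun i hi h => (ki i hi h).1) (fun i hi h => (ki i hi h).2)

/-- A subgroup of the centraliser of `e_{13}` normalising `E_6`. -/
def pushSubgroup : Subgroup (Br 6) :=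
  Subgroup.closure {push, delta 6 * push * (delta 6)⁻¹}

theorem push_mem : push ∈ pushSubgroup := Subgroup.subset_closure (by simp)

theorem conj_push_mem : delta 6 * push * (delta 6)⁻¹ ∈ pushSubgroup :=
  Subgroup.subset_closure (by simp)

theorem pushSubgroup_commute {c : Br 6} (hc : c ∈ pushSubgroup) : Commute c (e 6 1 3) := by
  have h : pushSubgroup ≤ Subgroup.centralizer {e 6 1 3} := by
    refine (Subgroup.closure_le _).2 ?_
    have h1 := commute_push_e (i := 1) le_rfl (by norm_num)
    have h2 : Commute (delta 6 * push * (delta 6)⁻¹) (e 6 1 3) := by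
      have a1 := sigma_mul_delta (n := 6) (i := 1) le_rfl (by norm_num)
      have a2 := sigma_mul_delta (n := 6) (i := 2) (by norm_num) (by norm_num)
      rw [← eq_mul_inv_iff_mul_eq] at a1 a2
      -- `push` commutes with e_{24}, and conjugation by δ carries e_{24} to e_{13}.
      have a3 : e 6 1 3 = delta 6 * e 6 2 4 * (delta 6)⁻¹ := by
        have a5 : delta 6 * (sigma 6 (2 + 1) * sigma 6 2 * (sigma 6 (2 + 1))⁻¹) * (delta 6)⁻¹ =
            (delta 6 * sigma 6 (2 + 1) * (delta 6)⁻¹) * (delta 6 * sigma 6 (1 + 1) * (delta 6)⁻¹) *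
              (delta 6 * sigma 6 (2 + 1) * (delta 6)⁻¹)⁻¹ := by
          simp [mul_assoc]
        rw [e_one_three, e_add_two 6 2, a5, ← a1, ← a2]
      have a4 : Commute push (e 6 2 4) := commute_push_e (i := 2) (by norm_num) (by norm_num)
      rw [a3]
      exact a4.map (MulAut.conj (delta 6))
    rintro x (rfl | rfl)
    · exact Subgroup.mem_centralizer_singleton_iff.2 h1.eq
    · exact Subgroup.mem_centralizer_singleton_iff.2 h2.eq
  exact Subgroup.mem_centralizer_singleton_iff.1 (h hc)

theorem pushSubgroup_le_normalizer :
    pushSubgroup ≤ Subgroup.normalizer (E 6 : Set (Br 6)) := by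
  refine (Subgroup.closure_le _).2 ?_
  rintro x (rfl | rfl)
  · exact push_mem_normalizer
  · exact Subgroup.mul_mem _ (Subgroup.mul_mem _ delta_mem_normalizer push_mem_normalizer)
      (Subgroup.inv_mem _ delta_mem_normalizer)

/-- The certified word is δ times (δ `push` δ⁻¹) `push`, and the second factor lies in
`pushSubgroup`. This justifies δ as a loop at the base node for n = 6. -/
theorem delta_mem_sup : delta 6 ∈ E 6 ⊔ pushSubgroup := by
  have h := wordVal_mem_of_mem_stabWords
    (w := [0, 0] ++ pushWord ++ [1] ++ pushWord) (by simp [stabWords])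
  have h' : delta 6 * (delta 6 * push * (delta 6)⁻¹ * push) ∈ E 6 := by
    simpa only [wordVal_append, wordVal_cons, wordVal_nil, mul_one, letterVal_zero, letterVal_one,
      mul_assoc, wordVal_pushWord] using h
  have hp : delta 6 * push * (delta 6)⁻¹ * push ∈ E 6 ⊔ pushSubgroup :=
    (le_sup_right : pushSubgroup ≤ _) (Subgroup.mul_mem _ conj_push_mem push_mem)
  exact (Subgroup.mul_mem_cancel_right _ hp).1 ((le_sup_left : E 6 ≤ _) h')

/-! ### The four cases. -/

theorem halfTwist_inter_E_three :
    {β : Br 3 | IsHalfTwist β} ∩ (E 3 : Set (Br 3)) =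
      {β : Br 3 | ∃ g ∈ E 3, β = g⁻¹ * e 3 1 3 * g} := by
  refine halfTwist_inter_E le_rfl ⊥ ?_ bot_le check_three complete_three
    (fun w hw x => by rw [wordVal_of_mem_relWords hw, one_smul])
    (fun w hw => (le_sup_left : E 3 ≤ _) (wordVal_mem_of_mem_eWords hw))
  rintro c hc
  rw [Subgroup.mem_bot.1 hc]
  exact Commute.one_left _

theorem halfTwist_inter_E_four :
    {β : Br 4 | IsHalfTwist β} ∩ (E 4 : Set (Br 4)) =
      {β : Br 4 | ∃ g ∈ E 4, β = g⁻¹ * e 4 1 3 * g} := by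
  refine halfTwist_inter_E (by norm_num) ⊥ ?_ bot_le check_four complete_four
    (fun w hw x => by rw [wordVal_of_mem_relWords hw, one_smul])
    (fun w hw => (le_sup_left : E 4 ≤ _) (wordVal_mem_of_mem_eWords hw))
  rintro c hc
  rw [Subgroup.mem_bot.1 hc]
  exact Commute.one_left _

theorem delta_pow_mem_center (n : ℕ) : delta n ^ n ∈ Subgroup.center (Br n) := by
  have h : (⊤ : Subgroup (Br n)) ≤ Subgroup.centralizer {delta n ^ n} := by
    rw [← closure_sigma, Subgroup.closure_le]
    rintro _ ⟨i, _, _, rfl⟩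
    exact Subgroup.mem_centralizer_singleton_iff.2 (commute_sigma_delta_pow n i).eq
  exact Subgroup.mem_center_iff.2 fun g => Subgroup.mem_centralizer_singleton_iff.1 (h trivial)

theorem halfTwist_inter_E_five :
    {β : Br 5 | IsHalfTwist β} ∩ (E 5 : Set (Br 5)) =
      {β : Br 5 | ∃ g ∈ E 5, β = g⁻¹ * e 5 1 3 * g} := by
  have hz := delta_pow_mem_center 5
  have hC : Subgroup.zpowers (delta 5 ^ 5) ≤ Subgroup.center (Br 5) := by
    rwa [Subgroup.zpowers_le]
  have hN : Subgroup.center (Br 5) ≤ Subgroup.normalizer (E 5 : Set (Br 5)) :=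
    Subgroup.center_le_normalizer _
  refine halfTwist_inter_E (by norm_num) (Subgroup.zpowers (delta 5 ^ 5)) ?_ (hC.trans hN) check_five
    complete_five ?_ (fun w hw => (le_sup_left : E 5 ≤ _) (wordVal_mem_of_mem_eWords hw))
  · exact fun c hc => (Subgroup.mem_center_iff.1 (hC hc) _).symm
  · intro w hw x
    rcases List.mem_append.1 hw with hw | hw
    · rw [wordVal_of_mem_relWords hw, one_smul]
    · rw [List.mem_singleton] at hw
      have hv : wordVal (scanGen 5) w = delta 5 ^ 5 := by
        rw [hw]
        simp [pow_succ, mul_assoc]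
      induction x using QuotientGroup.induction_on with
      | H a =>
        -- By centrality δ^5 a = a δ^5, which lies in the coset a C.
        rw [hv, MulAction.Quotient.smul_coe, smul_eq_mul, eq_comm, QuotientGroup.eq,
          ← Subgroup.mem_center_iff.1 hz a, inv_mul_cancel_left]
        exact (le_sup_right : Subgroup.zpowers _ ≤ _) (Subgroup.mem_zpowers _)

theorem halfTwist_inter_E_six :
    {β : Br 6 | IsHalfTwist β} ∩ (E 6 : Set (Br 6)) =
      {β : Br 6 | ∃ g ∈ E 6, β = g⁻¹ * e 6 1 3 * g} := by
  refine halfTwist_inter_E (by norm_num) pushSubgroup (fun _ => pushSubgroup_commute)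
    pushSubgroup_le_normalizer check_six complete_six
    (fun w hw x => by rw [wordVal_of_mem_relWords hw, one_smul]) fun w hw => ?_
  rcases List.mem_append.1 hw with hw | hw
  · exact (le_sup_left : E 6 ≤ _) (wordVal_mem_of_mem_eWords hw)
  · simp only [List.mem_cons, List.not_mem_nil, or_false] at hw
    rcases hw with rfl | rfl
    · rw [wordVal_cons, wordVal_nil, mul_one, letterVal_zero]
      exact delta_mem_sup
    · exact (le_sup_right : pushSubgroup ≤ _) push_mem

end ArtinBraid

theorem mainTheorem3 (n : ℕ) (hn3 : 3 ≤ n) (hn6 : n ≤ 6) :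
    {β : ArtinBraid.Br n | ArtinBraid.IsHalfTwist β} ∩ (ArtinBraid.E n : Set (ArtinBraid.Br n)) =
      {β : ArtinBraid.Br n | ∃ g ∈ ArtinBraid.E n, β = g⁻¹ * ArtinBraid.e n 1 3 * g} := by
  obtain rfl | rfl | rfl | rfl : n = 3 ∨ n = 4 ∨ n = 5 ∨ n = 6 := by omega
  · exact ArtinBraid.halfTwist_inter_E_three
  · exact ArtinBraid.halfTwist_inter_E_four
  · exact ArtinBraid.halfTwist_inter_E_five
  · exact ArtinBraid.halfTwist_inter_E_six
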